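/- For $K\ge 1$ let $H_K$ be the $K$-dimensional hypercube graph with vertex set $V_K=\{-1,+1\}^K$, two vertices being adjacent if and only if they differ in exactly one coordinate. Let $(Y_K(i))_{i\in\mathbb N}$ be the simple random walk on $H_K$ (at each step it jumps to a uniformly chosen neighbour) whose initial law is the uniform law on $V_K$. Put $f_K(v)=\sum_{i=1}^K v^{(i)}$ for $v\in V_K$ and, for $n\ge1$ and $t\ge 0$, $$X_{n,K}(t)=f_K\big(Y_K(\lfloor nt\rfloor)\big),\qquad Z_{n,K}(t)=\frac{X_{n,K}(t)}{\sqrt n},\qquad \Delta Z_{n,K}(t)=Z_{n,K}(t)-Z_{n,K}(0).$$ Let $K=K(n)$ be a sequence of integers such that, as $n\to\infty$, $K\to\infty$ and $\frac nK\to 0$. \textbf{Theorem.} Let $s\ge 1$, let $0\le t_1<t_2<\dots<t_s$ and let $\varphi\in\mathcal C_c^\infty(\mathbb R^s,\mathbb R)$ be a smooth compactly supported function. Then $$\sqrt{2\pi\frac Kn}\;\mathbb E\Big[\varphi\big(Z_{n,K}(t_1),\Delta Z_{n,K}(t_2),\dots,\Delta Z_{n,K}(t_s)\big)\Big]\;\underset{n\to\infty}{\longrightarrow}\;\int_{\mathbb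 R}\mathbb E\Big[\varphi\big(x,2W_{t_2},\dots,2W_{t_s}\big)\Big]\,dx,$$ where $(W_t)_{t\ge0}$ is a standard Brownian motion started from $0$. -/

import Mathlib

open MeasureTheory ProbabilityTheory Filter Topology
open scoped NNReal ENNReal

/-- The vertex set `{-1, +1}^K` of the `K`-dimensional hypercube
(`ℤˣ` is the two-element set of the integers `1` and `-1`). -/
abbrev Cube (K : ℕ) : Type := Fin K → ℤˣ

/-- The `K`-dimensional hypercube graph: the neighbours of a vertex `u` are the vertices obtained
from `u` by changing the sign of one coordinate. -/
def hypercubeGraph (K : ℕ) : SimpleGraph (Cube K) where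
  Adj u v := ∃ i : Fin K, v = Function.update u i (-u i)
  symm := ⟨by
    rintro u v ⟨i, rfl⟩
    exact ⟨i, by simp⟩⟩
  loopless := ⟨by
    rintro u ⟨i, hi⟩
    have h := congrFun hi i
    rw [Function.update_self] at h
    exact units_ne_neg_self (u i) h⟩

open scoped Classical in
/-- One-step transition probabilities of the simple random walk on a finite graph `G`: from `u`,
jump to a uniformly chosen neighbour of `u`. -/
noncomputable def srwStep {V : Type*} (G : SimpleGraph V) (u v : V) : ℝ≥0∞ :=
  if G.Adj u v then ((G.neighborSet u).ncard : ℝ≥0∞)⁻¹ else 0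

/-- `Y` is, under `P`, a simple random walk on the finite graph `G` with initial law `μ`:
a discrete-time Markov chain with initial law `μ` and transition probabilities `srwStep G`. -/
structure IsSimpleRandomWalk {V : Type*} [Finite V] (G : SimpleGraph V) (μ : PMF V)
    {Ω : Type*} [MeasurableSpace Ω] (P : Measure Ω) (Y : ℕ → Ω → V) : Prop where
  measurable : ∀ k, Measurable[_, ⊤] (Y k)
  law_path : ∀ (N : ℕ) (x : ℕ → V),
    P {ω | ∀ k ≤ N, Y k ω = x k} = μ (x 0) * ∏ k ∈ Finset.range N, srwStep G (x k) (x (k + 1))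

/-- The function `f_K`: the sum of the coordinates of a vertex of the hypercube. -/
noncomputable def coordSum {K : ℕ} (v : Cube K) : ℝ := ∑ i, ((v i : ℤ) : ℝ)

/-- The process `X_{n,K}(t) = f_K(Y_K(⌊nt⌋))`. -/
noncomputable def processX {K : ℕ} {Ω : Type*} (Y : ℕ → Ω → Cube K) (n : ℕ) (t : ℝ≥0) (ω : Ω) : ℝ :=
  coordSum (Y ⌊(n : ℝ≥0) * t⌋₊ ω)

/-- The rescaled process `Z_{n,K}(t) = n^{-1/2} X_{n,K}(t)`. -/
noncomputable def processZ {K : ℕ} {Ω : Type*} (Y : ℕ → Ω → Cube K) (n : ℕ) (t : ℝ≥0) (ω : Ω) : ℝ :=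
  processX Y n t ω / √(n : ℝ)

/-- The increment from time zero, `ΔZ_{n,K}(t) = Z_{n,K}(t) - Z_{n,K}(0)`. -/
noncomputable def deltaZ {K : ℕ} {Ω : Type*} (Y : ℕ → Ω → Cube K) (n : ℕ) (t : ℝ≥0) (ω : Ω) : ℝ :=
  processZ Y n t ω - processZ Y n 0 ω

/-! The integrand vanishes unless the height of the walk at time `k = ⌊n t₁⌋` is at most `M√n`.
Heights near the equator are spaced by `2` and each has probability about `√(2/(πK))`, so after
multiplication by `√(2πK/n)` each height carries mass about `2/√n`, the mesh of the rescaled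
heights. This is why Lebesgue measure appears in the limit.

The increments are measured from time `0` but the localisation is at time `k`, so the walk is
described from `Y k`. The uniform law is stationary and reversible: given `Y k = u`, past and future
are two independent walks from `u`, the increments of the past being reversed in order and sign
(`integral_two_sided`).

At height `q` the mean of the next sign is `-q/K`. A walk started with `q = O(√n)` keeps a mean
square height `O(n)` during `O(n)` steps, so replacing one step by a fair sign costs `O(√n/K)`,
times the step size `O(1/√n)`. Over all steps the cost is `O(n/K)`, which tends to `0`
(`abs_walkExp_sub_signAvg_le`, `abs_two_sided_sub_signAvg_le`).

With fair signs, height and increments decouple. For a fixed value `y` of the increments, the sum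
over vertices is nearly a Riemann sum, because binomial coefficients within `O(√n)` of the middle
agree up to a relative error `O(n/K)`; the error is uniform in `y` (`abs_sum_cube_sub_integral_le`).
The remaining average over signs converges by the central limit theorem, proved with characteristic
functions (`tendsto_integral_signMeasure`). -/

/-! ### Averages over the walk and over fair signs; reversibility -/

section Averages

variable {K : ℕ} {E : Type*} [NormedAddCommGroup E] [NormedSpace ℝ E]

/-- The vertex obtained from `u` by changing the sign of the coordinate `i`. -/
def flipCoord (u : Cube K) (i : Fin K) : Cube K := Function.update u i (-u i)

lemma flipCoord_flipCoord (u : Cube K) (i : Fin K) : flipCoord (flipCoord u i) i = u := by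
  simp [flipCoord]

lemma flipCoord_injective (u : Cube K) : Function.Injective (flipCoord u) := by
  intro i j h
  by_contra hij
  have h1 := congrFun h i
  simp only [flipCoord, Function.update_self, Function.update_of_ne hij] at h1
  exact units_ne_neg_self (u i) h1.symm

lemma coordSum_flipCoord (u : Cube K) (i : Fin K) :
    coordSum (flipCoord u i) = coordSum u - 2 * ((u i : ℤ) : ℝ) := by
  have h : ∀ v : Cube K, coordSum v = ((v i : ℤ) : ℝ) + ∑ j ∈ Finset.univ.erase i, ((v j : ℤ) : ℝ) :=
    fun v => (Finset.add_sum_erase _ _ (Finset.mem_univ i)).symm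
  have h2 : ∑ j ∈ Finset.univ.erase i, ((flipCoord u i j : ℤ) : ℝ)
      = ∑ j ∈ Finset.univ.erase i, ((u j : ℤ) : ℝ) := by
    refine Finset.sum_congr rfl fun j hj => ?_
    simp [flipCoord, Function.update_of_ne (Finset.ne_of_mem_erase hj)]
  rw [h (flipCoord u i), h u, h2]
  simp [flipCoord]
  ring

/-- Flipping a given coordinate is an involution of the cube. This is the source of both
stationarity and reversibility of the uniform law. -/
lemma sum_comp_flipCoord {M : Type*} [AddCommMonoid M] (g : Cube K → M) (i : Fin K) :
    ∑ u, g (flipCoord u i) = ∑ u, g u :=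
  Fintype.sum_equiv ⟨fun u => flipCoord u i, fun u => flipCoord u i,
    fun u => flipCoord_flipCoord u i, fun u => flipCoord_flipCoord u i⟩ _ _ fun _ => rfl

/-- The expectation of `H (Y N) (∑ l < N, (f (Y (l + 1)) - f (Y l)) • a l)`, where `Y` is the simple
random walk on the cube started from `u`, `f` is the sum of the coordinates, and `a` is a list of
length `N`. -/
noncomputable def walkExp : List E → (Cube K → E → ℝ) → Cube K → ℝ
  | [], H, u => H u 0
  | a :: l, H, u => (∑ i, walkExp l (fun w y =>
      H w ((coordSum (flipCoord u i) - coordSum u) • a + y)) (flipCoord u i)) / K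

/-- The expectation of `h (∑ l, 2 η l • a l)` for independent uniform signs `η`. -/
noncomputable def signAvg {V : Type*} [AddCommGroup V] [Module ℝ V] : List E → (E → V) → V
  | [], h => h 0
  | a :: l, h => (2⁻¹ : ℝ) • (signAvg l (fun y => h ((2 : ℝ) • a + y))
      + signAvg l (fun y => h ((-2 : ℝ) • a + y)))

lemma signAvg_append (l l' : List E) (h : E → ℝ) :
    signAvg (l ++ l') h = signAvg l fun x => signAvg l' fun y => h (x + y) := by
  induction l generalizing h with
  | nil => simp [signAvg]
  | cons a l ih => simp [signAvg, ih, add_assoc]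

lemma abs_signAvg_sub_le (l : List E) {h h' : E → ℝ} {C : ℝ} (hC : ∀ y, |h y - h' y| ≤ C) :
    |signAvg l h - signAvg l h'| ≤ C := by
  induction l generalizing h h' with
  | nil => exact hC 0
  | cons a l ih =>
    have h1 := ih (h := fun y => h ((2 : ℝ) • a + y)) (h' := fun y => h' ((2 : ℝ) • a + y))
      fun y => hC _
    have h2 := ih (h := fun y => h ((-2 : ℝ) • a + y)) (h' := fun y => h' ((-2 : ℝ) • a + y))
      fun y => hC _
    simp only [signAvg, smul_eq_mul]
    rw [abs_le] at *
    constructor <;> linarith [h1.1, h1.2, h2.1, h2.2]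

lemma abs_sum_div_le (hK : 0 < K) {g : Fin K → ℝ} {C : ℝ} (hg : ∀ i, |g i| ≤ C) :
    |(∑ i, g i) / K| ≤ C := by
  have hK' : (0 : ℝ) < K := by exact_mod_cast hK
  rw [abs_div, abs_of_pos hK', div_le_iff₀ hK']
  refine (Finset.abs_sum_le_sum_abs _ _).trans ((Finset.sum_le_sum fun i _ => hg i).trans ?_)
  simp [mul_comm]

lemma abs_walkExp_sub_le (hK : 0 < K) (l : List E) {H H' : Cube K → E → ℝ} {C : ℝ}
    (hC : ∀ w y, |H w y - H' w y| ≤ C) (u : Cube K) :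
    |walkExp l H u - walkExp l H' u| ≤ C := by
  induction l generalizing H H' u with
  | nil => exact hC u 0
  | cons a l ih =>
    simp only [walkExp]
    rw [← sub_div, ← Finset.sum_sub_distrib]
    exact abs_sum_div_le hK fun i => ih (fun w y => hC _ _) _

/-- While the walk stays close to the equator, its sign sequence is close to a sequence of
independent uniform signs. -/
lemma abs_walkExp_sub_signAvg_le (hK : 0 < K) {L α r : ℝ} (hL : 0 ≤ L) (hα : 0 ≤ α) (hr : 0 < r)
    (l : List E) (hl : ∀ a ∈ l, ‖a‖ ≤ α) {h : E → ℝ}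
    (hh : ∀ x y, |h x - h y| ≤ L * ‖x - y‖) (u : Cube K) :
    |walkExp l (fun _ => h) u - signAvg l h| ≤
      2 * L * α / K * (l.length * ((coordSum u ^ 2 + 4 * l.length) / r + r)) := by
  have hK' : (0 : ℝ) < K := by exact_mod_cast hK
  induction l generalizing h u with
  | nil => simp [walkExp, signAvg]
  | cons a l ih =>
    set N : ℝ := (l.length : ℝ) with hN
    have hN0 : 0 ≤ N := by positivity
    set q := coordSum u with hq
    set c : ℝ := 2 * L * α / K with hc
    have hc0 : 0 ≤ c := by positivity
    set g : E → ℝ := fun z => signAvg l fun y => h (z + y) with hg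
    have hgL : ∀ x y, |g x - g y| ≤ L * ‖x - y‖ := fun x y =>
      abs_signAvg_sub_le l fun z => by simpa using hh (x + z) (y + z)
    -- A function of a sign is affine in that sign, so averaging over `i` yields the fair average
    -- plus a drift proportional to `q / K`.
    have hgi : ∀ i, g ((coordSum (flipCoord u i) - q) • a) =
        (g ((2 : ℝ) • a) + g ((-2 : ℝ) • a)) / 2
          + ((u i : ℤ) : ℝ) * ((g ((-2 : ℝ) • a) - g ((2 : ℝ) • a)) / 2) := by
      intro i
      rw [coordSum_flipCoord]
      rcases Int.units_eq_one_or (u i) with h1 | h1 <;> rw [h1] <;> simp [hq] <;> ring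
    have h2 : |(∑ i, g ((coordSum (flipCoord u i) - q) • a)) / K - signAvg (a :: l) h| ≤
        c * (q ^ 2 / r + r) := by
      have e : (∑ i, g ((coordSum (flipCoord u i) - q) • a)) / K - signAvg (a :: l) h
          = q / K * ((g ((-2 : ℝ) • a) - g ((2 : ℝ) • a)) / 2) := by
        simp only [hgi, Finset.sum_add_distrib, ← Finset.sum_mul, signAvg, smul_eq_mul]
        have : ∑ i, ((u i : ℤ) : ℝ) = q := rfl
        rw [this]
        simp only [Finset.sum_const, Finset.card_univ, Fintype.card_fin, nsmul_eq_mul, hg]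
        field_simp
        ring
      have h4 : |g ((-2 : ℝ) • a) - g ((2 : ℝ) • a)| ≤ 4 * L * α := by
        refine (hgL _ _).trans ?_
        have h5 : ((-2 : ℝ) • a) - ((2 : ℝ) • a) = (-4 : ℝ) • a := by
          rw [← sub_smul]; norm_num
        rw [h5, norm_smul, Real.norm_eq_abs]
        have := hl a (by simp)
        norm_num
        nlinarith
      -- The error is linear in `|q|`; it is traded for `q ^ 2`, whose mean along the walk is easy
      -- to propagate. The parameter `r` will be `√n`.
      have h6 : |q| ≤ q ^ 2 / r + r := by
        rw [div_add' _ _ _ hr.ne', le_div_iff₀ hr, ← sq_abs]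
        nlinarith [sq_nonneg (|q| - r), abs_nonneg q, sq_nonneg (|q|), sq_nonneg r]
      rw [e, abs_mul, abs_div, abs_div, abs_of_pos hK', abs_two]
      calc |q| / K * (|g ((-2 : ℝ) • a) - g ((2 : ℝ) • a)| / 2)
          ≤ |q| / K * (4 * L * α / 2) := by gcongr
        _ = c * |q| := by rw [hc]; ring
        _ ≤ _ := by gcongr
    have h1 : |walkExp (a :: l) (fun _ => h) u
        - (∑ i, g ((coordSum (flipCoord u i) - q) • a)) / K| ≤
        c * (N * ((q ^ 2 + 4 + 4 * N) / r + r)) := by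
      simp only [walkExp]
      rw [← sub_div, ← Finset.sum_sub_distrib, abs_div, abs_of_pos hK', div_le_iff₀ hK']
      refine (Finset.abs_sum_le_sum_abs _ _).trans ((Finset.sum_le_sum fun i _ =>
        ih (fun b hb => hl b (by simp [hb]))
          (h := fun y => h ((coordSum (flipCoord u i) - coordSum u) • a + y))
          (fun x y => by
            simpa using hh ((coordSum (flipCoord u i) - coordSum u) • a + x)
              ((coordSum (flipCoord u i) - coordSum u) • a + y)) (flipCoord u i)).trans ?_)
      -- The mean square height grows by at most `4` per step, since the drift is towards the
      -- equator; hence `4 * l.length` in the bound.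
      have e : ∑ i, coordSum (flipCoord u i) ^ 2 = K * (q ^ 2 + 4) - 4 * q ^ 2 := by
        have : ∀ i, coordSum (flipCoord u i) ^ 2 = q ^ 2 + 4 - 4 * q * ((u i : ℤ) : ℝ) := by
          intro i
          rw [coordSum_flipCoord]
          rcases Int.units_eq_one_or (u i) with h1 | h1 <;> rw [h1] <;> simp [hq] <;> ring
        simp only [this, Finset.sum_sub_distrib, ← Finset.mul_sum]
        have : ∑ i, ((u i : ℤ) : ℝ) = q := rfl
        rw [this]
        simp
        ring
      have e2 : ∑ i, (coordSum (flipCoord u i) ^ 2 + 4 * N) / r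
          ≤ K * ((q ^ 2 + 4 + 4 * N) / r) := by
        rw [← Finset.sum_div, ← mul_div_assoc, Finset.sum_add_distrib, e]
        simp only [Finset.sum_const, Finset.card_univ, Fintype.card_fin, nsmul_eq_mul]
        gcongr
        nlinarith [sq_nonneg q]
      rw [← Finset.mul_sum, ← Finset.mul_sum, Finset.sum_add_distrib]
      simp only [Finset.sum_const, Finset.card_univ, Fintype.card_fin, nsmul_eq_mul]
      calc c * (N * (∑ i, (coordSum (flipCoord u i) ^ 2 + 4 * N) / r + K * r))
          ≤ c * (N * (K * ((q ^ 2 + 4 + 4 * N) / r) + K * r)) := by gcongr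
        _ = _ := by ring
    have h3 := (abs_sub_le _ _ _).trans (add_le_add h1 h2)
    refine h3.trans ?_
    rw [← mul_add]
    refine mul_le_mul_of_nonneg_left ?_ hc0
    simp only [List.length_cons, Nat.cast_add, Nat.cast_one, ← hN]
    have : (q ^ 2 / r) ≤ (q ^ 2 + 4 * (N + 1)) / r := by gcongr; nlinarith
    have e : q ^ 2 + 4 + 4 * N = q ^ 2 + 4 * (N + 1) := by ring
    rw [e]
    linarith

lemma walkExp_sum_div {ι : Type*} (s : Finset ι) (l : List E) (H : ι → Cube K → E → ℝ) (c : ℝ)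
    (u : Cube K) :
    walkExp l (fun w y => (∑ i ∈ s, H i w y) / c) u = (∑ i ∈ s, walkExp l (H i) u) / c := by
  induction l generalizing H u with
  | nil => rfl
  | cons a l ih =>
    simp only [walkExp, ih]
    rw [← Finset.sum_div, ← Finset.sum_div, Finset.sum_comm, div_right_comm]

/-- `walkExp` unfolds from the first step; time reversal needs it unfolded from the last. -/
lemma walkExp_concat (l : List E) (a : E) (H : Cube K → E → ℝ) (u : Cube K) :
    walkExp (l ++ [a]) H u = walkExp l (fun w y =>
      (∑ i, H (flipCoord w i) (y + (coordSum (flipCoord w i) - coordSum w) • a)) / K) u := by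
  induction l generalizing H u with
  | nil => simp [walkExp]
  | cons b l ih => simp [walkExp, ih, add_assoc]

/-- Reversibility of the walk with respect to the uniform law. -/
lemma sum_walkExp_reverse (l : List E) (G : Cube K → Cube K → E → ℝ) :
    ∑ v, walkExp l (G v) v =
      ∑ w, walkExp (l.map fun a => -a).reverse (fun v y => G v w y) w := by
  induction l generalizing G with
  | nil => simp [walkExp]
  | cons a l ih =>
    simp only [List.map_cons, List.reverse_cons, walkExp_concat, walkExp, walkExp_sum_div]
    rw [← Finset.sum_div, ← Finset.sum_div]
    congr 1
    rw [Finset.sum_comm, Finset.sum_comm (s := Finset.univ (α := Cube K))]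
    refine Finset.sum_congr rfl fun i _ => ?_
    -- The vertex after the first step becomes the summation variable. The starting vertex is then
    -- its neighbour, and the first step is read backwards, whence the sign change.
    rw [← sum_comp_flipCoord _ i]
    simp only [flipCoord_flipCoord]
    rw [ih fun v w y => G (flipCoord v i) w ((coordSum v - coordSum (flipCoord v i)) • a + y)]
    refine Finset.sum_congr rfl fun w _ => ?_
    congr 1
    funext v y
    congr 1
    rw [add_comm, smul_neg, ← neg_smul]
    congr 2
    ring

end Averages

/-! ### From the path probabilities to `walkExp`: the Markov property -/

section Markov

lemma integral_comp_of_finite {Ω ι : Type*} [MeasurableSpace Ω] [Fintype ι] (P : Measure Ω)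
    [IsFiniteMeasure P] (g : Ω → ι) (hg : ∀ x, MeasurableSet {ω | g ω = x}) (F : ι → ℝ) :
    ∫ ω, F (g ω) ∂P = ∑ x, P.real {ω | g ω = x} * F x := by
  classical
  have h : ∀ ω, F (g ω) = ∑ x, {ω | g ω = x}.indicator (fun _ => F x) ω := by
    intro ω
    simp [Set.indicator_apply]
  simp_rw [h]
  rw [integral_finsetSum _ fun x _ => (integrable_const _).indicator (hg x)]
  simp [integral_indicator_const _ (hg _)]

lemma ncard_neighborSet_hypercubeGraph {K : ℕ} (u : Cube K) :
    ((hypercubeGraph K).neighborSet u).ncard = K := by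
  have h : (hypercubeGraph K).neighborSet u = Set.range (flipCoord u) := by
    ext v
    simp only [SimpleGraph.mem_neighborSet, hypercubeGraph, flipCoord, Set.mem_range, eq_comm]
  rw [h, ← Nat.card_coe_set_eq, Nat.card_range_of_injective (flipCoord_injective u)]
  simp

lemma sum_srwStep_mul {K : ℕ} (u : Cube K) (F : Cube K → ℝ) :
    ∑ w, (srwStep (hypercubeGraph K) u w).toReal * F w = (∑ i, F (flipCoord u i)) / K := by
  classical
  have h : ∀ w, (srwStep (hypercubeGraph K) u w).toReal * F w
      = if w ∈ Finset.univ.image (flipCoord u) then F w / K else 0 := by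
    intro w
    have e : (hypercubeGraph K).Adj u w ↔ w ∈ Finset.univ.image (flipCoord u) := by
      simp [hypercubeGraph, flipCoord, eq_comm]
    rw [srwStep, ncard_neighborSet_hypercubeGraph]
    by_cases hw : (hypercubeGraph K).Adj u w
    · rw [if_pos hw, if_pos (e.1 hw)]
      simp [div_eq_inv_mul]
    · rw [if_neg hw, if_neg (mt e.2 hw)]
      simp
  simp_rw [h]
  rw [← Finset.sum_filter, Finset.filter_mem_eq_inter, Finset.univ_inter,
    Finset.sum_image fun i _ j _ hij => flipCoord_injective u hij, Finset.sum_div]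

variable {K : ℕ} {Ω : Type*} [MeasurableSpace Ω] {P : Measure Ω} [IsProbabilityMeasure P]
  {Y : ℕ → Ω → Cube K} {μ : PMF (Cube K)}

omit [IsProbabilityMeasure P] in
lemma IsSimpleRandomWalk.measurableSet_eq (hY : IsSimpleRandomWalk (hypercubeGraph K) μ P Y)
    (k : ℕ) (v : Cube K) : MeasurableSet {ω | Y k ω = v} :=
  hY.measurable k (t := {v}) trivial

omit [IsProbabilityMeasure P] in
lemma IsSimpleRandomWalk.measurableSet_path (hY : IsSimpleRandomWalk (hypercubeGraph K) μ P Y)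
    (N : ℕ) (x : ℕ → Cube K) : MeasurableSet {ω | ∀ k ≤ N, Y k ω = x k} := by
  have : {ω | ∀ k ≤ N, Y k ω = x k} = ⋂ k, ⋂ (_ : k ≤ N), {ω | Y k ω = x k} := by
    ext; simp
  rw [this]
  exact MeasurableSet.iInter fun k => MeasurableSet.iInter fun _ => hY.measurableSet_eq k _

/-- The Markov property at time `N`. -/
lemma IsSimpleRandomWalk.integral_step (hY : IsSimpleRandomWalk (hypercubeGraph K) μ P Y)
    (N : ℕ) (F : (ℕ → Cube K) → Cube K → ℝ) :
    ∫ ω, F (fun j => Y (min j N) ω) (Y (N + 1) ω) ∂P =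
      ∫ ω, (∑ i, F (fun j => Y (min j N) ω) (flipCoord (Y N ω) i)) / K ∂P := by
  classical
  -- Functionals of the past are functions of the path frozen at time `N`. It takes finitely many
  -- values, so the integrals become finite sums.
  let ex : (Fin (N + 1) → Cube K) → ℕ → Cube K :=
    fun x j => x ⟨min j N, Nat.lt_succ_of_le (min_le_right j N)⟩
  let g : Ω → Fin (N + 1) → Cube K := fun ω j => Y j ω
  have hex : ∀ ω, ex (g ω) = fun j => Y (min j N) ω := fun ω => rfl
  have hset : ∀ x, {ω | g ω = x} = {ω | ∀ k ≤ N, Y k ω = ex x k} := by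
    intro x
    ext ω
    simp only [Set.mem_ofPred_eq]
    constructor
    · rintro rfl k hk
      simp [hex, hk]
    · intro h
      funext j
      have := h j (Nat.lt_succ_iff.1 j.2)
      simp only [g, this, ex]
      congr 1
      ext
      simp [Nat.lt_succ_iff.1 j.2]
  have hset2 : ∀ x w, {ω | (g ω, Y (N + 1) ω) = (x, w)} =
      {ω | ∀ k ≤ N + 1, Y k ω = if k ≤ N then ex x k else w} := by
    intro x w
    ext ω
    have := Set.ext_iff.1 (hset x) ω
    simp only [Set.mem_ofPred_eq] at this
    simp only [Set.mem_ofPred_eq, Prod.mk.injEq, this]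
    constructor
    · rintro ⟨h1, h2⟩ k hk
      split_ifs with h
      · exact h1 k h
      · rw [show k = N + 1 by omega, h2]
    · intro h
      refine ⟨fun k hk => ?_, ?_⟩
      · simpa [hk] using h k (by omega)
      · simpa using h (N + 1) le_rfl
  have hprob : ∀ x w, P.real {ω | (g ω, Y (N + 1) ω) = (x, w)} =
      P.real {ω | g ω = x} * (srwStep (hypercubeGraph K) (ex x N) w).toReal := by
    intro x w
    rw [Measure.real, Measure.real, ← ENNReal.toReal_mul, hset, hset2, hY.law_path, hY.law_path,
      Finset.prod_range_succ, ← mul_assoc]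
    have e : ∏ k ∈ Finset.range N, srwStep (hypercubeGraph K) (if k ≤ N then ex x k else w)
          (if k + 1 ≤ N then ex x (k + 1) else w)
        = ∏ k ∈ Finset.range N, srwStep (hypercubeGraph K) (ex x k) (ex x (k + 1)) := by
      refine Finset.prod_congr rfl fun k hk => ?_
      have := Finset.mem_range.1 hk
      rw [if_pos (by omega), if_pos (by omega)]
    rw [e]
    simp
  have e1 := integral_comp_of_finite P (fun ω => (g ω, Y (N + 1) ω))
    (fun x => by rw [hset2 x.1 x.2]; exact hY.measurableSet_path _ _) (fun p => F (ex p.1) p.2)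
  have e2 := integral_comp_of_finite P g
    (fun x => by rw [hset x]; exact hY.measurableSet_path _ _)
    (fun x => (∑ i, F (ex x) (flipCoord (ex x N) i)) / K)
  simp only [hex, min_self] at e1 e2
  rw [e1, e2, Fintype.sum_prod_type]
  refine Finset.sum_congr rfl fun x _ => ?_
  simp only [hprob, mul_assoc, ← Finset.mul_sum, sum_srwStep_mul]

variable {E : Type*} [NormedAddCommGroup E] [NormedSpace ℝ E]

/-- The Markov property at time `k`, for functionals of the next `N` increments. -/
lemma IsSimpleRandomWalk.integral_eq_walkExp (hY : IsSimpleRandomWalk (hypercubeGraph K) μ P Y)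
    (a : ℕ → E) (N k : ℕ) (H : (ℕ → Cube K) → Cube K → E → ℝ) :
    ∫ ω, H (fun j => Y (min j k) ω) (Y (k + N) ω)
        (∑ l ∈ Finset.range N, (coordSum (Y (k + l + 1) ω) - coordSum (Y (k + l) ω)) • a (k + l)) ∂P
      = ∫ ω, walkExp ((List.range' k N).map a) (H fun j => Y (min j k) ω) (Y k ω) ∂P := by
  induction N generalizing k H with
  | zero => simp [walkExp]
  | succ N ih =>
    -- The first increment is moved into the past known at time `k + 1`, so that the induction
    -- hypothesis only sees the later ones.
    have h1 := ih (k + 1) fun p w y => H (fun j => p (min j k)) w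
      ((coordSum (p (k + 1)) - coordSum (p k)) • a k + y)
    have h2 := hY.integral_step k fun p w => walkExp ((List.range' (k + 1) N).map a) (fun w' y =>
      H p w' ((coordSum w - coordSum (p k)) • a k + y)) w
    have hm : ∀ j, min (min j k) (k + 1) = min j k := fun j => by omega
    simp only [hm, min_self, min_eq_left (Nat.le_succ k)] at h1 h2
    simp only [List.range'_succ, List.map_cons, walkExp]
    rw [← h2, ← h1]
    refine integral_congr_ae (Eventually.of_forall fun ω => ?_)
    simp only [Finset.sum_range_succ' _ N, add_zero]
    rw [show k + (N + 1) = k + 1 + N by ring]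
    congr 1
    rw [add_comm]
    congr 1
    refine Finset.sum_congr rfl fun l _ => ?_
    rw [show k + (l + 1) = k + 1 + l by ring]

lemma IsSimpleRandomWalk.integral_zero
    (hY : IsSimpleRandomWalk (hypercubeGraph K) (PMF.uniformOfFintype (Cube K)) P Y)
    (F : Cube K → ℝ) : ∫ ω, F (Y 0 ω) ∂P = (2⁻¹ : ℝ) ^ K * ∑ v, F v := by
  rw [integral_comp_of_finite P (Y 0) (hY.measurableSet_eq 0), Finset.mul_sum]
  refine Finset.sum_congr rfl fun v _ => ?_
  have h := hY.law_path 0 fun _ => v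
  simp only [Nat.le_zero, forall_eq, Finset.range_zero, Finset.prod_empty, mul_one,
    PMF.uniformOfFintype_apply] at h
  rw [Measure.real, h]
  simp

/-- Seen from its position at time `k`, which is uniform, the walk is made of two independent
walks. -/
lemma IsSimpleRandomWalk.integral_two_sided
    (hY : IsSimpleRandomWalk (hypercubeGraph K) (PMF.uniformOfFintype (Cube K)) P Y)
    (a : ℕ → E) (k N : ℕ) (H : Cube K → E → ℝ) :
    ∫ ω, H (Y k ω) (∑ l ∈ Finset.range (k + N),
        (coordSum (Y (l + 1) ω) - coordSum (Y l ω)) • a l) ∂P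
      = (2⁻¹ : ℝ) ^ K * ∑ u, walkExp (((List.range' 0 k).map a).map fun a => -a).reverse
        (fun _ x => walkExp ((List.range' k N).map a) (fun _ y => H u (x + y)) u) u := by
  -- The future after `k` is averaged with the past frozen; then the past is averaged from time `0`,
  -- with that average as terminal functional; then reversal moves the summation to the vertex at
  -- time `k`.
  have h1 := hY.integral_eq_walkExp a N k fun p _ y => H (p k) ((∑ l ∈ Finset.range k,
        (coordSum (p (l + 1)) - coordSum (p l)) • a l) + y)
  have h2 := hY.integral_eq_walkExp a k 0 fun _ w x =>
    walkExp ((List.range' k N).map a) (fun _ y => H w (x + y)) w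
  have h3 := hY.integral_zero fun v => walkExp ((List.range' 0 k).map a) (fun w x =>
    walkExp ((List.range' k N).map a) (fun _ y => H w (x + y)) w) v
  rw [sum_walkExp_reverse _ fun _ w x =>
    walkExp ((List.range' k N).map a) (fun _ y => H w (x + y)) w] at h3
  rw [← h3]
  simp only [min_self, zero_add] at h1 h2
  rw [← h2]
  have e : ∀ ω, ∑ l ∈ Finset.range k, (coordSum (Y (min (l + 1) k) ω)
      - coordSum (Y (min l k) ω)) • a l = ∑ l ∈ Finset.range k,
        (coordSum (Y (l + 1) ω) - coordSum (Y l ω)) • a l := fun ω =>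
    Finset.sum_congr rfl fun l hl => by
      have := Finset.mem_range.1 hl
      rw [min_eq_left (by omega), min_eq_left (by omega)]
  simp only [e] at h1
  rw [← h1]
  simp only [Finset.sum_range_add]

end Markov

/-! ### Binomial coefficients near the middle -/

section Binomial

lemma coordSum_eq {K : ℕ} (u : Cube K) :
    coordSum u = 2 * ((Finset.univ.filter fun i => u i = 1).card : ℝ) - K := by
  have h : ∀ i, ((u i : ℤ) : ℝ) = 2 * (if u i = 1 then 1 else 0) - 1 := by
    intro i
    rcases Int.units_eq_one_or (u i) with h1 | h1 <;> rw [h1] <;> norm_num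
  simp only [coordSum, h, Finset.sum_sub_distrib, ← Finset.mul_sum]
  simp

lemma sum_cube_coordSum {M : Type*} [AddCommMonoid M] (K : ℕ) (g : ℝ → M) :
    ∑ u : Cube K, g (coordSum u) = ∑ j ∈ Finset.range (K + 1), K.choose j • g (2 * j - K) := by
  classical
  have h := Finset.sum_powerset_apply_card (fun j : ℕ => g (2 * j - K)) (x := Finset.univ (α := Fin K))
  rw [Finset.card_univ, Fintype.card_fin] at h
  rw [← h, Finset.powerset_univ]
  refine Fintype.sum_equiv ⟨fun u => Finset.univ.filter fun i => u i = 1,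
    fun s i => if i ∈ s then 1 else -1, fun u => ?_, fun s => ?_⟩ _ _ fun u => ?_
  · funext i
    rcases Int.units_eq_one_or (u i) with h1 | h1 <;> simp [h1]
  · ext i
    by_cases hi : i ∈ s <;> simp [hi]
  · simp [coordSum_eq]

/-- Binomial coefficients near the middle are close to the largest one. -/
lemma choose_half_mul_le_choose {K : ℕ} (hK : 0 < K) (j : ℕ) (hj : j ≤ K) :
    (K.choose (K / 2) : ℝ) * (1 - (2 * j - K : ℝ) ^ 2 / K) ≤ K.choose j := by
  have hK' : (0 : ℝ) < K := by exact_mod_cast hK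
  -- Induction on the distance to the middle, in the upper half; the lower half follows by symmetry.
  have key : ∀ d : ℕ, ((K + 1) / 2 + d ≤ K) →
      (K.choose (K / 2) : ℝ) * (1 - (2 * ((K + 1) / 2 + d : ℕ) - K : ℝ) ^ 2 / K) ≤
        K.choose ((K + 1) / 2 + d) := by
    intro d
    induction d with
    | zero =>
      intro _
      have : K.choose (K / 2) = K.choose ((K + 1) / 2) := by
        rw [← Nat.choose_symm (Nat.div_le_self K 2)]
        congr 1
        omega
      rw [add_zero, this]
      have h0 : (0 : ℝ) ≤ (2 * ((K + 1) / 2 : ℕ) - K : ℝ) ^ 2 / K := by positivity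
      have h1 : (0 : ℝ) ≤ K.choose ((K + 1) / 2) := by positivity
      nlinarith
    | succ d ih =>
      intro hd
      have ih := ih (by omega)
      set i := (K + 1) / 2 + d with hi
      rw [show (K + 1) / 2 + (d + 1) = i + 1 by omega] at hd ⊢
      set b : ℝ := ((K.choose (K / 2) : ℕ) : ℝ) with hb
      have hb0 : 0 ≤ b := by positivity
      have hrec : (K.choose (i + 1) : ℝ) * (i + 1) = K.choose i * (K - i) := by
        have := Nat.choose_succ_right_eq K i
        rw [← Nat.cast_sub (by omega)]
        exact_mod_cast this
      have hx : (0 : ℝ) ≤ 2 * i - K := by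
        have : K ≤ 2 * i := by omega
        have : (K : ℝ) ≤ 2 * i := by exact_mod_cast this
        linarith
      set x : ℝ := 2 * i - K with hxd
      have hix : (i : ℝ) = (K + x) / 2 := by rw [hxd]; ring
      push_cast
      rw [show (2 * ((i : ℝ) + 1) - K) = x + 2 by rw [hxd]; ring]
      -- If this factor is negative, the left side is nonpositive and there is nothing to prove.
      -- Otherwise it bounds the ratio of consecutive coefficients from below.
      by_cases hneg : (1 : ℝ) - (2 * x + 2) / K < 0
      · have : 1 - (x + 2) ^ 2 / K ≤ 0 := by
          have : (2 * x + 2) / K ≤ (x + 2) ^ 2 / K := by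
            gcongr
            nlinarith
          linarith
        exact (mul_nonpos_of_nonneg_of_nonpos hb0 this).trans (by positivity)
      push Not at hneg
      have hi1 : (0 : ℝ) < i + 1 := by positivity
      have h1 : (1 - (2 * x + 2) / K) ≤ (K - i) / (i + 1) := by
        rw [le_div_iff₀ hi1, hix]
        field_simp
        nlinarith
      have h2 : (K.choose (i + 1) : ℝ) = K.choose i * ((K - i) / (i + 1)) := by
        rw [← mul_div_assoc, eq_div_iff hi1.ne', hrec]
      rw [h2]
      calc b * (1 - (x + 2) ^ 2 / K) ≤ b * ((1 - x ^ 2 / K) * (1 - (2 * x + 2) / K)) := by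
            gcongr
            field_simp
            nlinarith [mul_nonneg (sq_nonneg x) hx, sq_nonneg x]
        _ = b * (1 - x ^ 2 / K) * (1 - (2 * x + 2) / K) := by ring
        _ ≤ K.choose i * (1 - (2 * x + 2) / K) := by gcongr
        _ ≤ _ := by gcongr
  by_cases h : (K + 1) / 2 ≤ j
  · obtain ⟨d, rfl⟩ := Nat.exists_eq_add_of_le h
    exact key d hj
  · obtain ⟨d, hd⟩ := Nat.exists_eq_add_of_le (show (K + 1) / 2 ≤ K - j by omega)
    have := key d (by omega)
    rw [← hd, Nat.choose_symm hj, Nat.cast_sub hj] at this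
    convert this using 4
    ring

/-- The asymptotics of the largest binomial coefficient. -/
lemma tendsto_sqrt_mul_choose_half :
    Tendsto (fun K : ℕ => √(Real.pi * K / 2) * (2⁻¹ : ℝ) ^ K * K.choose (K / 2)) atTop (𝓝 1) := by
  have hπ : √Real.pi ≠ 0 := by positivity
  -- The even case is the limit of `stirlingSeq (2r) / stirlingSeq r ^ 2`.
  have heven : Tendsto (fun r : ℕ => √(Real.pi * r) * (4⁻¹ : ℝ) ^ r * r.centralBinom) atTop
      (𝓝 1) := by
    have h := Stirling.tendsto_stirlingSeq_sqrt_pi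
    have h2 := (h.comp (tendsto_id.const_mul_atTop' (two_pos (α := ℕ)))).div (h.pow 2)
      (pow_ne_zero 2 hπ)
    have h3 := h2.const_mul √Real.pi
    rw [show √Real.pi * (√Real.pi / √Real.pi ^ 2) = 1 by field_simp] at h3
    refine h3.congr' ?_
    filter_upwards [eventually_gt_atTop 0] with r hr
    have hr' : (0 : ℝ) < r := by exact_mod_cast hr
    have hc : (r.centralBinom : ℝ) = (2 * r).factorial / (r.factorial : ℝ) ^ 2 := by
      rw [eq_div_iff (by positivity), Nat.centralBinom_eq_two_mul_choose, sq]
      have := Nat.choose_mul_factorial_mul_factorial (show r ≤ 2 * r by omega)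
      rw [show 2 * r - r = r by omega] at this
      rw [← this]
      push_cast
      ring
    simp only [Function.comp, id, Pi.div_apply, Stirling.stirlingSeq, hc]
    have e4 : (4⁻¹ : ℝ) ^ r = (1 / 2) ^ (2 * r) := by rw [pow_mul]; norm_num
    rw [e4, Real.sqrt_mul Real.pi_pos.le]
    push_cast
    rw [show (2 : ℝ) * (2 * r) = 4 * r by ring, Real.sqrt_mul (by norm_num) (r : ℝ),
      show √(4 : ℝ) = 2 by rw [show (4 : ℝ) = 2 ^ 2 by norm_num]; simp,
      Real.sqrt_mul (by norm_num) (r : ℝ)]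
    have hs : √(r : ℝ) ≠ 0 := by positivity
    have hs2 : √(2 : ℝ) ^ 2 = 2 := by simp
    have hs3 : √(r : ℝ) ^ 2 = r := Real.sq_sqrt hr'.le
    have he : Real.exp 1 ≠ 0 := (Real.exp_pos 1).ne'
    have hpow : (2 * (r : ℝ) / Real.exp 1) ^ (2 * r) = 2 ^ (2 * r) * ((r / Real.exp 1) ^ r) ^ 2 := by
      rw [mul_div_assoc, mul_pow]
      congr 1
      rw [← pow_mul, mul_comm r 2]
    rw [hpow, one_div, inv_pow]
    have hp : (r / Real.exp 1) ^ r ≠ 0 := by positivity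
    field_simp
    exact hs2
  have hratio : Tendsto (fun K : ℕ => √((K : ℝ) / (2 * ((K + 1) / 2 : ℕ)))) atTop (𝓝 1) := by
    rw [← Real.sqrt_one]
    refine (Real.continuous_sqrt.tendsto 1).comp ?_
    refine tendsto_of_tendsto_of_tendsto_of_le_of_le' (tendsto_natCast_div_add_atTop (1 : ℝ))
      tendsto_const_nhds ?_ ?_
    · filter_upwards [eventually_gt_atTop 0] with K hK
      have h1 : 0 < (K + 1) / 2 := by omega
      have h1' : (0 : ℝ) < ((K + 1) / 2 : ℕ) := by exact_mod_cast h1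
      have h2 : 2 * ((K + 1) / 2) ≤ K + 1 := by omega
      have h2' : 2 * (((K + 1) / 2 : ℕ) : ℝ) ≤ K + 1 := by exact_mod_cast h2
      gcongr
    · filter_upwards with K
      have h2 : K ≤ 2 * ((K + 1) / 2) := by omega
      have h2' : (K : ℝ) ≤ 2 * (((K + 1) / 2 : ℕ) : ℝ) := by exact_mod_cast h2
      exact div_le_one_of_le₀ h2' (by positivity)
  have hhalf : Tendsto (fun K : ℕ => (K + 1) / 2) atTop atTop :=
    tendsto_atTop_atTop.2 fun b => ⟨2 * b, fun a ha => by omega⟩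
  have h := (heven.comp hhalf).mul hratio
  rw [one_mul] at h
  refine h.congr' ?_
  filter_upwards [eventually_gt_atTop 0] with K hK
  simp only [Function.comp]
  set r := (K + 1) / 2 with hr
  have hr' : (0 : ℝ) < r := by
    have : 0 < r := by omega
    exact_mod_cast this
  have hsq : √(Real.pi * r) * √((K : ℝ) / (2 * r)) = √(Real.pi * K / 2) := by
    rw [← Real.sqrt_mul (by positivity)]
    congr 1
    field_simp
  -- Exact for both parities with `r = ⌈K/2⌉`: for `K = 2c + 1`, the central coefficient of `2c + 2`
  -- is twice that of `K`. Only the square root factor needs the correction `hratio`.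
  have hch : (4⁻¹ : ℝ) ^ r * r.centralBinom = (2⁻¹ : ℝ) ^ K * K.choose (K / 2) := by
    have e4 : (4⁻¹ : ℝ) ^ r = (2⁻¹) ^ (2 * r) := by rw [pow_mul]; norm_num
    rw [e4, Nat.centralBinom_eq_two_mul_choose]
    rcases Nat.even_or_odd' K with ⟨c, hc | hc⟩
    · have : r = c := by omega
      rw [this, hc, show 2 * c / 2 = c by omega]
    · have : r = c + 1 := by omega
      rw [this, hc, show (2 * c + 1) / 2 = c by omega, show 2 * (c + 1) = 2 * c + 1 + 1 by ring,
        Nat.choose_succ_succ, ← Nat.choose_symm_half, pow_succ]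
      push_cast
      ring
  rw [mul_assoc, mul_assoc, ← mul_assoc (4⁻¹ ^ r), hch, ← hsq]
  ring

end Binomial

/-! ### Laws of sums of independent signs and products of cosines -/

section SignMeasure

variable {E : Type*} [NormedAddCommGroup E] [InnerProductSpace ℝ E] [MeasurableSpace E]
  [BorelSpace E] [SecondCountableTopology E]

/-- The law of `∑ l, 2 η l • a l` for independent uniform signs `η`. -/
noncomputable def signMeasure : List E → Measure E
  | [] => Measure.dirac 0
  | a :: l => (2⁻¹ : ℝ≥0∞) • ((signMeasure l).map (fun y => (2 : ℝ) • a + y)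
      + (signMeasure l).map (fun y => (-2 : ℝ) • a + y))

instance isProbabilityMeasure_signMeasure (l : List E) : IsProbabilityMeasure (signMeasure l) := by
  induction l with
  | nil => rw [signMeasure]; infer_instance
  | cons a l ih =>
    have h1 := Measure.isProbabilityMeasure_map (μ := signMeasure l)
      (f := fun y => (2 : ℝ) • a + y) (by fun_prop)
    have h2 := Measure.isProbabilityMeasure_map (μ := signMeasure l)
      (f := fun y => (-2 : ℝ) • a + y) (by fun_prop)
    constructor
    rw [signMeasure, Measure.smul_apply, Measure.add_apply, measure_univ, measure_univ, smul_eq_mul,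
      one_add_one_eq_two, ENNReal.inv_mul_cancel (by simp) (by simp)]

lemma integrable_signMeasure_and_integral_eq {V : Type*} [NormedAddCommGroup V] [NormedSpace ℝ V]
    [CompleteSpace V] (l : List E) {h : E → V} (hh : Continuous h) :
    Integrable h (signMeasure l) ∧ ∫ y, h y ∂(signMeasure l) = signAvg l h := by
  induction l generalizing h with
  | nil =>
    refine ⟨integrable_dirac (by simp), ?_⟩
    simp [signMeasure, signAvg]
  | cons a l ih =>
    obtain ⟨i1, e1⟩ := ih (h := fun y => h ((2 : ℝ) • a + y)) (by fun_prop)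
    obtain ⟨i2, e2⟩ := ih (h := fun y => h ((-2 : ℝ) • a + y)) (by fun_prop)
    have m1 : AEMeasurable (fun y => (2 : ℝ) • a + y) (signMeasure l) := by fun_prop
    have m2 : AEMeasurable (fun y => (-2 : ℝ) • a + y) (signMeasure l) := by fun_prop
    have s1 : AEStronglyMeasurable h ((signMeasure l).map fun y => (2 : ℝ) • a + y) :=
      hh.aestronglyMeasurable
    have s2 : AEStronglyMeasurable h ((signMeasure l).map fun y => (-2 : ℝ) • a + y) :=
      hh.aestronglyMeasurable
    have j1 := (integrable_map_measure s1 m1).2 i1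
    have j2 := (integrable_map_measure s2 m2).2 i2
    refine ⟨(j1.add_measure j2).smul_measure (by simp), ?_⟩
    rw [signMeasure, integral_smul_measure, integral_add_measure j1 j2, integral_map m1 s1,
      integral_map m2 s2, e1, e2, signAvg]
    simp

omit [MeasurableSpace E] [BorelSpace E] [SecondCountableTopology E] in
lemma signAvg_const_mul (l : List E) (c : ℂ) (h : E → ℂ) :
    signAvg l (fun y => c * h y) = c * signAvg l h := by
  induction l generalizing h with
  | nil => rfl
  | cons a l ih =>
    simp only [signAvg, ih, ← mul_add, mul_smul_comm]

/-- Each fair sign contributes a cosine. As the cosine is even and the product commutative,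
reversing the list or changing signs of steps does not affect the law. -/
lemma charFun_signMeasure (l : List E) (t : E) :
    charFun (signMeasure l) t = ((l.map fun a => Real.cos (2 * inner ℝ a t)).prod : ℝ) := by
  rw [charFun_apply, (integrable_signMeasure_and_integral_eq l (by fun_prop)).2]
  induction l with
  | nil => simp [signAvg]
  | cons a l ih =>
    simp only [signAvg, inner_add_left, Complex.ofReal_add, add_mul, Complex.exp_add,
      signAvg_const_mul, ih, List.map_cons, List.prod_cons, Complex.ofReal_mul, Complex.ofReal_cos]
    rw [← add_mul, ← smul_mul_assoc]
    congr 1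
    have := Complex.two_cos ((2 * inner ℝ a t : ℝ) : ℂ)
    simp only [inner_smul_left, Complex.real_smul]
    simp only [Complex.ofReal_mul, Complex.ofReal_ofNat, neg_mul] at this
    simp [← this]

/-- Telescoping, one factor being exchanged at a time, as in Lindeberg's argument. -/
lemma abs_prod_sub_prod_le {a b : ℕ → ℝ} (ha : ∀ l, |a l| ≤ 1) (hb : ∀ l, |b l| ≤ 1) (N : ℕ) :
    |∏ l ∈ Finset.range N, a l - ∏ l ∈ Finset.range N, b l|
      ≤ ∑ l ∈ Finset.range N, |a l - b l| := by
  induction N with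
  | zero => simp
  | succ N ih =>
    rw [Finset.prod_range_succ, Finset.prod_range_succ, Finset.sum_range_succ]
    have h1 : |∏ l ∈ Finset.range N, b l| ≤ 1 := by
      rw [Finset.abs_prod]
      exact Finset.prod_le_one (fun _ _ => abs_nonneg _) fun l _ => hb l
    set A := ∏ l ∈ Finset.range N, a l
    set B := ∏ l ∈ Finset.range N, b l
    have e : A * a N - B * b N = (A - B) * a N + B * (a N - b N) := by ring
    rw [e]
    refine (abs_add_le _ _).trans ?_
    rw [abs_mul, abs_mul]
    have := mul_le_mul_of_nonneg_left (ha N) (abs_nonneg (A - B))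
    have := mul_le_mul_of_nonneg_right h1 (abs_nonneg (a N - b N))
    linarith

/-- Each `cos θ` differs from `exp (-θ²/2)` by at most `θ⁴ ≤ δ² θ²`, and these errors sum to `δ²`
times a convergent sequence. -/
lemma tendsto_prod_cos {N : ℕ → ℕ} {θ : ℕ → ℕ → ℝ} {δ : ℕ → ℝ} {σ : ℝ}
    (hδ : Tendsto δ atTop (𝓝 0)) (hθ : ∀ n l, |θ n l| ≤ δ n)
    (hσ : Tendsto (fun n => ∑ l ∈ Finset.range (N n), θ n l ^ 2) atTop (𝓝 σ)) :
    Tendsto (fun n => ∏ l ∈ Finset.range (N n), Real.cos (θ n l)) atTop (𝓝 (Real.exp (-(σ / 2)))) := by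
  have h1 : Tendsto (fun n => ∏ l ∈ Finset.range (N n), Real.exp (-(θ n l ^ 2 / 2))) atTop
      (𝓝 (Real.exp (-(σ / 2)))) := by
    simp only [← Real.exp_sum, Finset.sum_neg_distrib, ← Finset.sum_div]
    exact (Real.continuous_exp.tendsto _).comp (hσ.div_const 2).neg
  have h2 : Tendsto (fun n => δ n ^ 2 * ∑ l ∈ Finset.range (N n), θ n l ^ 2) atTop (𝓝 0) := by
    simpa using (hδ.pow 2).mul hσ
  have hδ1 : ∀ᶠ n in atTop, δ n < 1 := hδ.eventually (gt_mem_nhds one_pos)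
  have h3 : Tendsto (fun n => ∏ l ∈ Finset.range (N n), Real.cos (θ n l)
      - ∏ l ∈ Finset.range (N n), Real.exp (-(θ n l ^ 2 / 2))) atTop (𝓝 0) := by
    refine squeeze_zero_norm' ?_ h2
    filter_upwards [hδ1] with n hn
    refine (abs_prod_sub_prod_le (fun l => Real.abs_cos_le_one _) (fun l => ?_) _).trans ?_
    · rw [abs_of_pos (Real.exp_pos _), Real.exp_le_one_iff]
      nlinarith [sq_nonneg (θ n l)]
    · rw [Finset.mul_sum]
      refine Finset.sum_le_sum fun l _ => ?_
      have hx : |θ n l| ≤ 1 := (hθ n l).trans hn.le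
      have hx2 : θ n l ^ 2 ≤ δ n ^ 2 := by
        rw [← sq_abs]
        exact pow_le_pow_left₀ (abs_nonneg _) (hθ n l) 2
      have hx3 : θ n l ^ 2 ≤ 1 := by
        rw [← sq_abs]
        exact pow_le_one₀ (abs_nonneg _) hx
      have hc := Real.cos_bound hx
      have he := Real.abs_exp_sub_one_sub_id_le (x := -(θ n l ^ 2 / 2)) (by
        rw [abs_neg, abs_of_nonneg (by positivity)]
        linarith)
      have h4 : |θ n l| ^ 4 = (θ n l ^ 2) ^ 2 := by
        rw [show 4 = 2 * 2 by norm_num, pow_mul, sq_abs]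
      rw [h4] at hc
      have h5 : (θ n l ^ 2) ^ 2 ≤ δ n ^ 2 * θ n l ^ 2 := by
        rw [sq (θ n l ^ 2)]
        exact mul_le_mul_of_nonneg_right hx2 (sq_nonneg _)
      have h6 : 0 ≤ (θ n l ^ 2) ^ 2 := by positivity
      rw [abs_le] at hc he ⊢
      constructor <;> nlinarith [hc.1, hc.2, he.1, he.2]
  simpa using h3.add h1

end SignMeasure

/-! ### Central limit theorem towards `2 W` -/

section CentralLimit

variable {m : ℕ}

/-- The contribution, to the increments up to the times `k j`, of a unit step at time `l`,
normalised by `√n`. -/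
noncomputable def stepVec (n : ℕ) (k : Fin m → ℕ) (l : ℕ) : EuclideanSpace ℝ (Fin m) :=
  WithLp.toLp 2 fun j => if l < k j then (√(n : ℝ))⁻¹ else 0

lemma norm_stepVec_le (n : ℕ) (k : Fin m → ℕ) (l : ℕ) :
    ‖stepVec n k l‖ ≤ √m * (√(n : ℝ))⁻¹ := by
  have h : ∑ j, ‖stepVec n k l j‖ ^ 2 ≤ (√m * (√(n : ℝ))⁻¹) ^ 2 := by
    rw [mul_pow, Real.sq_sqrt (by positivity)]
    refine (Finset.sum_le_sum (g := fun _ => (√(n : ℝ))⁻¹ ^ 2) fun j _ => ?_).trans (by simp)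
    simp only [stepVec]
    split_ifs
    · simp
    · simp
  rw [EuclideanSpace.norm_eq]
  exact Real.sqrt_le_iff.2 ⟨by positivity, h⟩

/-- Coordinates `i` and `j` share exactly the steps before `min (k i) (k j)`: the discrete form of
the Brownian covariance. -/
lemma sum_inner_stepVec_sq (n : ℕ) (k : Fin m → ℕ) (N : ℕ) (hN : ∀ j, k j ≤ N)
    (x : EuclideanSpace ℝ (Fin m)) :
    ∑ l ∈ Finset.range N, (2 * inner ℝ (stepVec n k l) x) ^ 2
      = ∑ i, ∑ j, 4 * (x i * x j) * ((min (k i) (k j) : ℕ) / n : ℝ) := by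
  have h : ∀ l, (2 * inner ℝ (stepVec n k l) x) ^ 2 = ∑ i, ∑ j, 4 * (x i * x j) *
      ((if l < min (k i) (k j) then (1 : ℝ) else 0) / n) := by
    intro l
    have e : inner ℝ (stepVec n k l) x = ∑ i, x i * (if l < k i then (√(n : ℝ))⁻¹ else 0) := by
      simp [PiLp.inner_apply, stepVec]
    rw [e, mul_pow, sq (∑ i, _), Finset.sum_mul_sum, Finset.mul_sum]
    refine Finset.sum_congr rfl fun i _ => ?_
    rw [Finset.mul_sum]
    refine Finset.sum_congr rfl fun j _ => ?_
    have hs : (√(n : ℝ))⁻¹ * (√(n : ℝ))⁻¹ = 1 / n := by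
      rw [← mul_inv, Real.mul_self_sqrt (by positivity), one_div]
    by_cases h1 : l < k i <;> by_cases h2 : l < k j <;> simp [h1, h2]
    rw [show x i * (√(n : ℝ))⁻¹ * (x j * (√(n : ℝ))⁻¹) = x i * x j * ((√(n : ℝ))⁻¹ * (√(n : ℝ))⁻¹)
      by ring, hs]
    ring
  simp only [h]
  rw [Finset.sum_comm]
  refine Finset.sum_congr rfl fun i _ => ?_
  rw [Finset.sum_comm]
  refine Finset.sum_congr rfl fun j _ => ?_
  rw [← Finset.mul_sum, ← Finset.sum_div]
  congr 2
  have hf : (Finset.range N).filter (fun l => l < min (k i) (k j)) = Finset.range (min (k i) (k j)) := by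
    ext l
    have := hN i
    simp only [Finset.mem_filter, Finset.mem_range]
    omega
  rw [← Finset.sum_filter, hf]
  simp

variable {Ω' : Type*} [MeasurableSpace Ω'] {P' : Measure Ω'} [IsProbabilityMeasure P']
  {W : ℝ≥0 → Ω' → ℝ}

omit [IsProbabilityMeasure P'] in
lemma ProbabilityTheory.IsPreBrownianReal.hasGaussianLaw_pi (hW : IsPreBrownianReal W P')
    (t : Fin m → ℝ≥0) : HasGaussianLaw (fun ω (j : Fin m) => W (t j) ω) P' := by
  have h := (hW.isGaussianProcess.comp_right t).hasGaussianLaw Finset.univ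
  exact h.map_fun (ContinuousLinearMap.pi fun j : Fin m =>
    ContinuousLinearMap.proj (R := ℝ) (φ := fun _ : (Finset.univ : Finset (Fin m)) => ℝ)
      ⟨j, Finset.mem_univ j⟩)

/-- The law of `(2 W (t j))_j`. -/
noncomputable def limitLaw (P' : Measure Ω') (W : ℝ≥0 → Ω' → ℝ) (t : Fin m → ℝ≥0) :
    Measure (EuclideanSpace ℝ (Fin m)) :=
  P'.map fun ω => WithLp.toLp 2 fun j => 2 * W (t j) ω

lemma charFun_limitLaw (hW : IsPreBrownianReal W P') (t : Fin m → ℝ≥0)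
    (x : EuclideanSpace ℝ (Fin m)) :
    charFun (limitLaw P' W t) x =
      Real.exp (-((∑ i, ∑ j, 4 * (x i * x j) * (min (t i) (t j) : ℝ≥0)) / 2)) := by
  have hG : HasGaussianLaw (fun ω => (WithLp.toLp 2 fun j => 2 * W (t j) ω :
      EuclideanSpace ℝ (Fin m))) P' :=
    HasGaussianLaw.toLp_pi 2 (X := fun j ω => 2 * W (t j) ω) ((hW.hasGaussianLaw_pi t).fun_smul 2)
  have hin : ∀ ω, inner ℝ x (WithLp.toLp 2 fun j => 2 * W (t j) ω : EuclideanSpace ℝ (Fin m))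
      = ∑ i, (2 * x i) * W (t i) ω := by
    intro ω
    simp only [PiLp.inner_apply, RCLike.inner_apply, conj_trivial]
    exact Finset.sum_congr rfl fun i _ => by ring
  have hL : ∀ i, MemLp (fun ω => (2 * x i) * W (t i) ω) 2 P' := fun i =>
    (hW.isGaussianProcess.hasGaussianLaw_eval (t i)).memLp_two.const_mul _
  rw [limitLaw, hG.charFun_map_eq]
  simp only [hin]
  rw [integral_finsetSum _ fun i _ => (hL i).integrable (by simp), variance_fun_sum hL]
  simp only [integral_const_mul, hW.integral_eval, covariance_const_mul_left,
    covariance_const_mul_right, hW.covariance_fun_eval]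
  rw [Complex.ofReal_exp]
  congr 1
  simp only [mul_zero, Finset.sum_const_zero, Complex.ofReal_zero, zero_mul, zero_sub]
  push_cast
  congr 2
  refine Finset.sum_congr rfl fun i _ => Finset.sum_congr rfl fun j _ => ?_
  ring

/-- The central limit theorem for the increments of a simple random walk with steps `±2`. -/
lemma tendsto_integral_signMeasure (hW : IsPreBrownianReal W P') (t : Fin m → ℝ≥0)
    (k : ℕ → Fin m → ℕ) (N : ℕ → ℕ) (hN : ∀ n j, k n j ≤ N n)
    (hk : ∀ j, Tendsto (fun n : ℕ => (k n j : ℝ) / n) atTop (𝓝 (t j)))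
    (l : ℕ → List (EuclideanSpace ℝ (Fin m)))
    (hl : ∀ n x, ((l n).map fun a => Real.cos (2 * inner ℝ a x)).prod =
      (((List.range (N n)).map (stepVec n (k n))).map fun a => Real.cos (2 * inner ℝ a x)).prod)
    {h : EuclideanSpace ℝ (Fin m) → ℝ} (hc : Continuous h) {C : ℝ} (hC : ∀ y, |h y| ≤ C) :
    Tendsto (fun n => ∫ y, h y ∂(signMeasure (l n))) atTop (𝓝 (∫ y, h y ∂(limitLaw P' W t))) := by
  have hWm : AEMeasurable (fun ω => (WithLp.toLp 2 fun j => 2 * W (t j) ω :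
      EuclideanSpace ℝ (Fin m))) P' :=
    (HasGaussianLaw.toLp_pi 2 (X := fun j ω => 2 * W (t j) ω)
      ((hW.hasGaussianLaw_pi t).fun_smul 2)).aemeasurable
  have hp : IsProbabilityMeasure (limitLaw P' W t) := Measure.isProbabilityMeasure_map hWm
  let ν : ℕ → ProbabilityMeasure (EuclideanSpace ℝ (Fin m)) := fun n => ⟨signMeasure (l n), inferInstance⟩
  let ν₀ : ProbabilityMeasure (EuclideanSpace ℝ (Fin m)) := ⟨limitLaw P' W t, hp⟩
  have hlim : Tendsto ν atTop (𝓝 ν₀) := by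
    refine ProbabilityMeasure.tendsto_iff_tendsto_charFun.2 fun x => ?_
    change Tendsto (fun n => charFun (signMeasure (l n)) x) atTop (𝓝 (charFun (limitLaw P' W t) x))
    rw [charFun_limitLaw hW]
    -- The list of steps matters only through its product of cosines, so it may be replaced by the
    -- chronological list.
    simp only [charFun_signMeasure, hl]
    refine (Complex.continuous_ofReal.tendsto _).comp ?_
    simp only [List.map_map]
    have hprod : ∀ n, ((List.range (N n)).map ((fun a => Real.cos (2 * inner ℝ a x)) ∘
        stepVec n (k n))).prod = ∏ i ∈ Finset.range (N n),
          Real.cos (2 * inner ℝ (stepVec n (k n) i) x) := fun n => by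
      induction N n with
      | zero => simp
      | succ M ih => simp [List.range_succ, Finset.prod_range_succ, ih]
    simp only [hprod]
    refine tendsto_prod_cos (δ := fun n => 2 * (√m * (√(n : ℝ))⁻¹ * ‖x‖)) ?_ (fun n i => ?_) ?_
    · have : Tendsto (fun n : ℕ => (√(n : ℝ))⁻¹) atTop (𝓝 0) :=
        tendsto_inv_atTop_zero.comp (Real.tendsto_sqrt_atTop.comp tendsto_natCast_atTop_atTop)
      simpa using ((this.const_mul √m).mul_const ‖x‖).const_mul 2
    · rw [abs_mul, abs_two]
      gcongr
      exact (abs_real_inner_le_norm _ _).trans (by gcongr; exact norm_stepVec_le _ _ _)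
    · simp only [fun n => sum_inner_stepVec_sq n (k n) (N n) (hN n) x]
      refine tendsto_finsetSum _ fun i _ => tendsto_finsetSum _ fun j _ => Tendsto.const_mul _ ?_
      have := (hk i).min (hk j)
      push_cast
      refine this.congr fun n => ?_
      rw [min_div_div_right (by positivity)]
  have := ProbabilityMeasure.tendsto_iff_forall_integral_tendsto.1 hlim
    (BoundedContinuousFunction.ofNormedAddCommGroup h hc C hC)
  exact this

end CentralLimit

/-! ### Local limit theorem on the cube by Riemann sums -/

section RiemannSum

/-- The normalised largest binomial coefficient, which tends to `1`. -/
noncomputable def midWeight (K : ℕ) : ℝ := √(Real.pi * K / 2) * (2⁻¹ : ℝ) ^ K * K.choose (K / 2)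

lemma midWeight_nonneg (K : ℕ) : 0 ≤ midWeight K := by unfold midWeight; positivity

/-- The heights `2j - K` are spaced by `2`, so an interval of length `2R` holds at most `R + 1` of
them. -/
lemma card_filter_abs_le (K : ℕ) {R : ℝ} (hR : 0 ≤ R) :
    (((Finset.range (K + 1)).filter fun j : ℕ => |(2 * j - K : ℝ)| ≤ R).card : ℝ) ≤ R + 1 := by
  have h : ((Finset.range (K + 1)).filter fun j : ℕ => |(2 * j - K : ℝ)| ≤ R) ⊆
      Finset.Icc ⌈(K - R) / 2⌉₊ ⌊(K + R) / 2⌋₊ := by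
    intro j hj
    have := abs_le.1 (Finset.mem_filter.1 hj).2
    rw [Finset.mem_Icc, Nat.ceil_le, Nat.le_floor_iff (by positivity)]
    constructor <;> linarith [this.1, this.2]
  have h1 : (((Finset.range (K + 1)).filter fun j : ℕ => |(2 * j - K : ℝ)| ≤ R).card : ℝ) ≤
      (⌊(K + R) / 2⌋₊ + 1 - ⌈(K - R) / 2⌉₊ : ℕ) := by
    rw [← Nat.card_Icc]
    exact_mod_cast Finset.card_le_card h
  refine h1.trans ?_
  have h2 := Nat.floor_le (show (0 : ℝ) ≤ (K + R) / 2 by positivity)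
  have h3 := Nat.le_ceil ((K - R) / 2 : ℝ)
  by_cases h4 : ⌈(K - R) / 2⌉₊ ≤ ⌊(K + R) / 2⌋₊ + 1
  · rw [Nat.cast_sub h4]
    push_cast
    linarith
  · rw [Nat.sub_eq_zero_of_le (by omega)]
    simp
    linarith

/-- Only cells meeting the support count, at most `M * s + 3` of them, each with an error (Lipschitz
constant) × (mesh)². The hypothesis `M * s < K` makes the grid cover the support. -/
lemma abs_riemann_sum_sub_integral_le (K : ℕ) {s L M : ℝ} (hs : 0 < s) (hL : 0 ≤ L) (hM : 0 ≤ M)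
    (hK : M * s < K) {g : ℝ → ℝ} (hg : ∀ x y, |g x - g y| ≤ L * |x - y|)
    (hgM : ∀ x, M < |x| → g x = 0) :
    |∑ j ∈ Finset.range (K + 1), 2 / s * g ((2 * j - K) / s) - ∫ x, g x| ≤
      (M * s + 3) * (L * (2 / s) * (2 / s)) := by
  have hgc : Continuous g := by
    refine (LipschitzWith.of_dist_le_mul (K := L.toNNReal) fun x y => ?_).continuous
    rw [Real.dist_eq, Real.dist_eq, Real.coe_toNNReal _ hL]
    exact hg x y
  set p : ℕ → ℝ := fun j => (2 * j - K) / s with hp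
  have hstep : ∀ j, p (j + 1) = p j + 2 / s := by
    intro j
    simp only [hp]
    push_cast
    field_simp
    ring
  have hint : ∫ x, g x = ∑ j ∈ Finset.range (K + 1), ∫ x in p j..p (j + 1), g x := by
    rw [intervalIntegral.sum_integral_adjacent_intervals fun j _ => hgc.intervalIntegrable _ _,
      intervalIntegral.integral_eq_integral_of_support_subset]
    intro x hx
    have hxM : |x| ≤ M := not_lt.1 fun h => hx (hgM x h)
    have h1 : M < K / s := (lt_div_iff₀ hs).2 hK
    have h2 : p 0 = -(K / s) := by simp only [hp]; push_cast; ring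
    have h3 : K / s ≤ p (K + 1) := by
      simp only [hp]
      push_cast
      gcongr
      linarith
    rw [abs_le] at hxM
    constructor <;> linarith [hxM.1, hxM.2]
  rw [hint, ← Finset.sum_sub_distrib]
  refine (Finset.abs_sum_le_sum_abs _ _).trans ?_
  have hterm : ∀ j ∈ Finset.range (K + 1), |2 / s * g (p j) - ∫ x in p j..p (j + 1), g x| ≤
      if |(2 * j - K : ℝ)| ≤ M * s + 2 then L * (2 / s) * (2 / s) else 0 := by
    intro j _
    have e : 2 / s * g (p j) - ∫ x in p j..p (j + 1), g x
        = ∫ x in p j..p (j + 1), (g (p j) - g x) := by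
      rw [intervalIntegral.integral_sub (by simp) (hgc.intervalIntegrable _ _), hstep]
      simp
    have hs2 : 0 < 2 / s := by positivity
    have hmem : ∀ x ∈ Set.uIoc (p j) (p (j + 1)), |p j - x| ≤ 2 / s := by
      intro x hx
      rw [Set.uIoc_of_le (by rw [hstep]; linarith), hstep] at hx
      rw [abs_le]
      constructor <;> linarith [hx.1, hx.2]
    rw [e]
    split_ifs with hj
    · rw [← Real.norm_eq_abs]
      refine (intervalIntegral.norm_integral_le_of_norm_le_const (C := L * (2 / s))
        (f := fun x => g (p j) - g x) fun x hx => ?_).trans ?_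
      · exact (hg _ _).trans (by gcongr; exact hmem x hx)
      · rw [hstep, add_sub_cancel_left, abs_of_pos hs2]
    -- The margin of one mesh `2 / s` ensures that the whole cell lies outside the support.
    · have hpj : M + 2 / s < |p j| := by
        simp only [hp]
        rw [abs_div, abs_of_pos hs, lt_div_iff₀ hs, add_mul, div_mul_cancel₀ _ hs.ne']
        exact not_le.1 hj
      rw [← Real.norm_eq_abs]
      refine (intervalIntegral.norm_integral_le_of_norm_le_const (C := 0)
        (f := fun x => g (p j) - g x) fun x hx => ?_).trans (by simp)
      have h1 : |p j| ≤ |p j - x| + |x| := by simpa using abs_add_le (p j - x) x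
      rw [hgM (p j) (by linarith), hgM x (by linarith [hmem x hx])]
      simp
  refine (Finset.sum_le_sum hterm).trans ?_
  rw [← Finset.sum_filter, Finset.sum_const, nsmul_eq_mul]
  gcongr
  refine (card_filter_abs_le K (by positivity)).trans ?_
  linarith

lemma sqrt_mul_pow_mul_choose (K n : ℕ) (hn : 0 < n) :
    √(2 * Real.pi * (K / n)) * (2⁻¹ : ℝ) ^ K * K.choose (K / 2) = 2 / √n * midWeight K := by
  have h : √(2 * Real.pi * (K / n)) = 2 / √n * √(Real.pi * K / 2) := by
    have hn' : (0 : ℝ) < n := by exact_mod_cast hn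
    rw [show (2 : ℝ) / √n = √(4 / n) by
      rw [Real.sqrt_div (by norm_num), show (4 : ℝ) = 2 ^ 2 by norm_num, Real.sqrt_sq (by norm_num)],
      ← Real.sqrt_mul (by positivity)]
    congr 1
    field_simp
    ring
  rw [h, midWeight]
  ring

/-- Near the equator, the number of vertices at each height is at most of order `1 / √n` after
normalisation. -/
lemma sum_cube_le_of_support (K n : ℕ) (hn : 0 < n) {M C : ℝ} (hM : 0 ≤ M) (hC : 0 ≤ C)
    (F : Cube K → ℝ)
    (hF : ∀ u, |F u| ≤ if |coordSum u| ≤ M * √n then C else 0) :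
    |√(2 * Real.pi * (K / n)) * ((2⁻¹ : ℝ) ^ K * ∑ u, F u)| ≤ 2 * (M + 1) * midWeight K * C := by
  have hs : 1 ≤ √(n : ℝ) := Real.one_le_sqrt.2 (by exact_mod_cast hn)
  have h1 : |∑ u, F u| ≤ (M * √n + 1) * (K.choose (K / 2) * C) := by
    refine (Finset.abs_sum_le_sum_abs _ _).trans ((Finset.sum_le_sum fun u _ => hF u).trans ?_)
    rw [sum_cube_coordSum K fun x => if |x| ≤ M * √n then C else 0]
    simp only [nsmul_eq_mul, mul_ite, mul_zero]
    rw [← Finset.sum_filter]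
    refine (Finset.sum_le_card_nsmul _ _ (K.choose (K / 2) * C) fun j _ => ?_).trans ?_
    · gcongr
      exact_mod_cast Nat.choose_le_middle j K
    · rw [nsmul_eq_mul]
      gcongr
      exact card_filter_abs_le K (by positivity)
  rw [abs_mul, abs_mul, abs_of_nonneg (Real.sqrt_nonneg _), abs_of_nonneg (by positivity)]
  calc √(2 * Real.pi * (K / n)) * ((2⁻¹ : ℝ) ^ K * |∑ u, F u|)
      ≤ √(2 * Real.pi * (K / n)) * ((2⁻¹ : ℝ) ^ K * ((M * √n + 1) * (K.choose (K / 2) * C))) := by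
        gcongr
    _ = (√(2 * Real.pi * (K / n)) * (2⁻¹ : ℝ) ^ K * K.choose (K / 2)) * ((M * √n + 1) * C) := by
        ring
    _ = 2 * (M + 1 / √n) * midWeight K * C := by
        rw [sqrt_mul_pow_mul_choose K n hn]
        field_simp
    _ ≤ _ := by
        have := midWeight_nonneg K
        gcongr
        exact div_le_one_of_le₀ hs (by positivity)

/-- The local limit theorem for the uniform law on the cube, in the window of size `√n`. -/
lemma abs_sum_cube_sub_integral_le (K n : ℕ) (hK : 0 < K) (hn : 0 < n) {L M B : ℝ} (hL : 0 ≤ L)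
    (hM : 0 ≤ M) (hMK : M * √n < K) {g : ℝ → ℝ} (hg : ∀ x y, |g x - g y| ≤ L * |x - y|)
    (hgM : ∀ x, M < |x| → g x = 0) (hgB : ∀ x, |g x| ≤ B) :
    |√(2 * Real.pi * (K / n)) * ((2⁻¹ : ℝ) ^ K * ∑ u : Cube K, g (coordSum u / √n)) - ∫ x, g x| ≤
      2 * (M + 1) * (B * (|midWeight K - 1| + midWeight K * (M ^ 2 * (n / K))))
        + 4 * L * (M + 3) / √n := by
  have hs : 1 ≤ √(n : ℝ) := Real.one_le_sqrt.2 (by exact_mod_cast hn)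
  have hs0 : 0 < √(n : ℝ) := by positivity
  have hss : √(n : ℝ) ^ 2 = n := Real.sq_sqrt (by positivity)
  have hB : 0 ≤ B := (abs_nonneg _).trans (hgB 0)
  have hK' : (0 : ℝ) < K := by exact_mod_cast hK
  have hk0 := midWeight_nonneg K
  have h1 := abs_riemann_sum_sub_integral_le K hs0 hL hM hMK hg hgM
  have h2 : (M * √n + 3) * (L * (2 / √n) * (2 / √n)) ≤ 4 * L * (M + 3) / √n := by
    rw [show (M * √n + 3) * (L * (2 / √n) * (2 / √n)) = 4 * L * (M + 3 / √n) / √n by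
      field_simp; norm_num]
    gcongr
    exact div_le_self (by norm_num) hs
  have hmid : (0 : ℝ) < K.choose (K / 2) := by
    exact_mod_cast Nat.choose_pos (Nat.div_le_self K 2)
  set D : ℝ := |midWeight K - 1| + midWeight K * (M ^ 2 * (n / K)) with hD
  have h3 : |√(2 * Real.pi * (K / n)) * ((2⁻¹ : ℝ) ^ K * ∑ u : Cube K, g (coordSum u / √n))
      - ∑ j ∈ Finset.range (K + 1), 2 / √n * g ((2 * j - K) / √n)| ≤ 2 * (M + 1) * (B * D) := by
    rw [sum_cube_coordSum K fun x => g (x / √n), Finset.mul_sum, Finset.mul_sum,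
      ← Finset.sum_sub_distrib]
    refine (Finset.abs_sum_le_sum_abs _ _).trans ?_
    have hterm : ∀ j ∈ Finset.range (K + 1),
        |√(2 * Real.pi * (K / n)) * ((2⁻¹ : ℝ) ^ K * K.choose j • g ((2 * j - K) / √n))
          - 2 / √n * g ((2 * j - K) / √n)| ≤
        if |(2 * j - K : ℝ)| ≤ M * √n then 2 / √n * (B * D) else 0 := by
      intro j hj
      split_ifs with hjM
      · have e : √(2 * Real.pi * (K / n)) * ((2⁻¹ : ℝ) ^ K * K.choose j • g ((2 * j - K) / √n))
            - 2 / √n * g ((2 * j - K) / √n) = 2 / √n * (g ((2 * j - K) / √n) *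
              (midWeight K * (K.choose j / K.choose (K / 2)) - 1)) := by
          have := sqrt_mul_pow_mul_choose K n hn
          rw [mul_sub, mul_sub]
          congr 1
          · rw [← mul_assoc, mul_comm (g _), ← mul_assoc, ← mul_assoc, ← this, nsmul_eq_mul]
            field_simp
          · ring
        rw [e, abs_mul, abs_mul, abs_of_pos (by positivity : (0 : ℝ) < 2 / √n)]
        gcongr
        · exact hgB _
        · set ρ : ℝ := K.choose j / K.choose (K / 2) with hρ
          have hρ1 : ρ ≤ 1 := div_le_one_of_le₀ (by exact_mod_cast Nat.choose_le_middle j K) hmid.le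
          have hρ2 : 1 - M ^ 2 * (n / K) ≤ ρ := by
            rw [hρ, le_div_iff₀ hmid, mul_comm]
            refine le_trans ?_ (choose_half_mul_le_choose hK j
              (Nat.lt_succ_iff.1 (Finset.mem_range.1 hj)))
            gcongr
            rw [← mul_div_assoc, ← hss, ← mul_pow, ← sq_abs (2 * (j : ℝ) - K)]
            gcongr
          rw [show midWeight K * ρ - 1 = (midWeight K - 1) + midWeight K * (ρ - 1) by ring]
          refine (abs_add_le _ _).trans ?_
          rw [abs_mul, abs_of_nonneg hk0, abs_of_nonpos (by linarith : ρ - 1 ≤ 0), hD]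
          gcongr
          linarith
      · rw [hgM]
        · simp
        · rw [abs_div, abs_of_pos hs0, lt_div_iff₀ hs0]
          exact not_le.1 hjM
    refine (Finset.sum_le_sum hterm).trans ?_
    rw [← Finset.sum_filter, Finset.sum_const, nsmul_eq_mul]
    calc _ ≤ (M * √n + 1) * (2 / √n * (B * D)) := by
          gcongr
          exact card_filter_abs_le K (by positivity)
      _ = 2 * (M + 1 / √n) * (B * D) := by field_simp
      _ ≤ _ := by
          gcongr
          exact div_le_one_of_le₀ hs (by positivity)
  exact (abs_sub_le _ _ _).trans (add_le_add h3 (h1.trans h2))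

end RiemannSum

/-! ### Replacing the walk by signs and passing to the limit -/

section Assembly

/-- The list of steps of the two-sided walk seen from time `k`: first the time-reversed past, then
the next `N` steps. -/
noncomputable def twoSidedSteps {E : Type*} [NormedAddCommGroup E] (a : ℕ → E) (k N : ℕ) : List E :=
  (((List.range' 0 k).map a).map fun x => -x).reverse ++ (List.range' k N).map a

lemma prod_cos_twoSidedSteps {E : Type*} [NormedAddCommGroup E] [InnerProductSpace ℝ E]
    (a : ℕ → E) (k N : ℕ) (x : E) :
    ((twoSidedSteps a k N).map fun a => Real.cos (2 * inner ℝ a x)).prod =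
      (((List.range (k + N)).map a).map fun a => Real.cos (2 * inner ℝ a x)).prod := by
  have h : List.range' 0 k ++ List.range' k N = List.range (k + N) := by
    rw [List.range_eq_range', ← List.range'_append]
    simp
  rw [← h]
  simp [twoSidedSteps, Function.comp_def]

lemma continuous_uncurry_of_lipschitz {E : Type*} [NormedAddCommGroup E] {h : ℝ → E → ℝ} {L : ℝ}
    (hL : 0 ≤ L) (hh : ∀ x x' y y', |h x y - h x' y'| ≤ L * (|x - x'| + ‖y - y'‖)) :
    Continuous (Function.uncurry h) := by
  refine (LipschitzWith.of_dist_le_mul (K := (2 * L).toNNReal) fun p q => ?_).continuous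
  rw [Real.dist_eq, Real.coe_toNNReal _ (by positivity), Prod.dist_eq, mul_comm 2 L, mul_assoc]
  refine (hh p.1 q.1 p.2 q.2).trans (mul_le_mul_of_nonneg_left ?_ hL)
  rw [← Real.dist_eq, ← dist_eq_norm]
  linarith [le_max_left (dist p.1 q.1) (dist p.2 q.2), le_max_right (dist p.1 q.1) (dist p.2 q.2)]

/-- On the window of size `√n`, the two-sided walk is close to a walk with independent uniform
signs. -/
lemma abs_two_sided_sub_signAvg_le {E : Type*} [NormedAddCommGroup E] [NormedSpace ℝ E] {K n : ℕ}
    (hK : 0 < K) (hn : 0 < n) {L M T β : ℝ} (hL : 0 ≤ L) (hT : 0 ≤ T) (hβ : 0 ≤ β)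
    {a : ℕ → E} (ha : ∀ l, ‖a l‖ ≤ β * (√(n : ℝ))⁻¹) {k N : ℕ} (hN : ((k + N : ℕ) : ℝ) ≤ T * n)
    {h : E → ℝ} (hh : ∀ x y, |h x - h y| ≤ L * ‖x - y‖) (u : Cube K)
    (hu : |coordSum u| ≤ M * √n) :
    |walkExp (((List.range' 0 k).map a).map fun x => -x).reverse
        (fun _ x => walkExp ((List.range' k N).map a) (fun _ y => h (x + y)) u) u
      - signAvg (twoSidedSteps a k N) h| ≤ 4 * L * β * T * (M ^ 2 + 4 * T + 1) * (n / K) := by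
  have hn' : (0 : ℝ) < n := by exact_mod_cast hn
  have hK' : (0 : ℝ) < K := by exact_mod_cast hK
  have hs0 : 0 < √(n : ℝ) := by positivity
  have hss : √(n : ℝ) ^ 2 = n := Real.sq_sqrt (by positivity)
  have hq : coordSum u ^ 2 ≤ M ^ 2 * n := by
    rw [← hss, ← mul_pow, ← sq_abs]
    gcongr
  -- With the free parameter equal to `√n`, each of at most `T * n` steps costs `O(√n/K)` times
  -- `β/√n`.
  have hbound : ∀ r : ℕ, (r : ℝ) ≤ T * n →
      2 * L * (β * (√(n : ℝ))⁻¹) / K * (r * ((coordSum u ^ 2 + 4 * r) / √n + √n)) ≤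
        2 * L * β * T * (M ^ 2 + 4 * T + 1) * (n / K) := by
    intro r hr
    calc 2 * L * (β * (√(n : ℝ))⁻¹) / K * (r * ((coordSum u ^ 2 + 4 * r) / √n + √n))
        ≤ 2 * L * (β * (√(n : ℝ))⁻¹) / K * ((T * n) * ((M ^ 2 * n + 4 * (T * n)) / √n + √n)) := by
          gcongr
      _ = 2 * L * β * T * ((M ^ 2 + 4 * T) * (n / √n ^ 2) + 1) * (n / K) := by
          field_simp
      _ = _ := by
          rw [hss, div_self hn'.ne']
          ring
  have hkN : (k : ℝ) ≤ T * n ∧ (N : ℝ) ≤ T * n := by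
    push_cast at hN
    constructor <;> linarith [Nat.cast_nonneg (α := ℝ) k, Nat.cast_nonneg (α := ℝ) N]
  have h1 := abs_walkExp_sub_le hK (((List.range' 0 k).map a).map fun x => -x).reverse
    (H := fun _ x => walkExp ((List.range' k N).map a) (fun _ y => h (x + y)) u)
    (H' := fun _ x => signAvg ((List.range' k N).map a) fun y => h (x + y))
    (C := 2 * L * β * T * (M ^ 2 + 4 * T + 1) * (n / K)) (fun w x => by
      refine (abs_walkExp_sub_signAvg_le hK hL (α := β * (√(n : ℝ))⁻¹) (by positivity) hs0 _
        (fun b hb => ?_)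
        (fun y z => by simpa using hh (x + y) (x + z)) u).trans
        ((hbound N hkN.2).trans' (by simp))
      obtain ⟨l, -, rfl⟩ := List.mem_map.1 hb
      exact ha l) u
  have h2 := abs_walkExp_sub_signAvg_le hK hL (by positivity) hs0
    (((List.range' 0 k).map a).map fun x => -x).reverse (α := β * (√(n : ℝ))⁻¹) (fun b hb => by
      simp only [List.mem_reverse, List.map_map, List.mem_map, Function.comp] at hb
      obtain ⟨l, -, rfl⟩ := hb
      simpa using ha l)
    (h := fun x => signAvg ((List.range' k N).map a) fun y => h (x + y))
    (fun x y => abs_signAvg_sub_le _ fun z => by simpa using hh (x + z) (y + z)) u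
  rw [twoSidedSteps, signAvg_append]
  refine (abs_sub_le _ _ _).trans ((add_le_add h1 (h2.trans
    ((hbound k hkN.1).trans' (by simp)))).trans (by linarith))

lemma tendsto_floor_mul_div (t : ℝ≥0) :
    Tendsto (fun n : ℕ => (⌊(n : ℝ≥0) * t⌋₊ : ℝ) / n) atTop (𝓝 t) := by
  have h := (tendsto_nat_floor_mul_div_atTop (R := ℝ) t.2).comp tendsto_natCast_atTop_atTop
  refine h.congr fun n => ?_
  have : ⌊(n : ℝ≥0) * t⌋₊ = ⌊(t : ℝ) * n⌋₊ := by
    refine eq_of_forall_le_iff fun c => ?_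
    rw [Nat.le_floor_iff (by positivity), Nat.le_floor_iff (by positivity), ← NNReal.coe_le_coe]
    push_cast
    rw [mul_comm]
  simp [this]

lemma sum_increments_smul_stepVec {K m : ℕ} {Ω : Type*} (Y : ℕ → Ω → Cube K) (n : ℕ)
    (s : Fin m → ℝ≥0) (N : ℕ) (hN : ∀ j, ⌊(n : ℝ≥0) * s j⌋₊ ≤ N) (ω : Ω) (j : Fin m) :
    (∑ l ∈ Finset.range N, (coordSum (Y (l + 1) ω) - coordSum (Y l ω)) •
      stepVec n (fun j => ⌊(n : ℝ≥0) * s j⌋₊) l) j = deltaZ Y n (s j) ω := by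
  have hf : (Finset.range N).filter (fun l => l < ⌊(n : ℝ≥0) * s j⌋₊)
      = Finset.range ⌊(n : ℝ≥0) * s j⌋₊ := by
    ext l
    have := hN j
    simp only [Finset.mem_filter, Finset.mem_range]
    omega
  simp only [WithLp.ofLp_sum, Finset.sum_apply, WithLp.ofLp_smul, Pi.smul_apply, stepVec,
    smul_eq_mul, mul_ite, mul_zero]
  rw [← Finset.sum_filter, hf, ← Finset.sum_mul,
    Finset.sum_range_sub fun l => coordSum (Y l ω)]
  simp [deltaZ, processZ, processX, div_eq_mul_inv, sub_mul]

/-- The limit theorem, for a Lipschitz function of the position and the increments which vanishes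
when the position is large. -/
lemma tendsto_integral_of_lipschitz {m : ℕ}
    {Ω : ℕ → Type*} [∀ K, MeasurableSpace (Ω K)] (P : ∀ K, Measure (Ω K))
    [∀ K, IsProbabilityMeasure (P K)] (Y : ∀ K, ℕ → Ω K → Cube K)
    (hY : ∀ K, 1 ≤ K →
      IsSimpleRandomWalk (hypercubeGraph K) (PMF.uniformOfFintype (Cube K)) (P K) (Y K))
    (K : ℕ → ℕ) (hK : Tendsto K atTop atTop)
    (hslow : Tendsto (fun n : ℕ => (n : ℝ) / (K n : ℝ)) atTop (𝓝 0))
    {Ω' : Type*} [MeasurableSpace Ω'] (P' : Measure Ω') [IsProbabilityMeasure P']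
    (W : ℝ≥0 → Ω' → ℝ) (hW : IsPreBrownianReal W P')
    (t₀ : ℝ≥0) (s : Fin m → ℝ≥0)
    (h : ℝ → EuclideanSpace ℝ (Fin m) → ℝ) {L M B : ℝ} (hL : 0 ≤ L) (hM : 0 ≤ M)
    (hh : ∀ x x' y y', |h x y - h x' y'| ≤ L * (|x - x'| + ‖y - y'‖))
    (hhM : ∀ x y, M < |x| → h x y = 0) (hhB : ∀ x y, |h x y| ≤ B) :
    Tendsto
      (fun n : ℕ => √(2 * Real.pi * ((K n : ℝ) / (n : ℝ))) *
        ∫ ω, h (processZ (Y (K n)) n t₀ ω)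
          (WithLp.toLp 2 fun j => deltaZ (Y (K n)) n (s j) ω) ∂(P (K n)))
      atTop
      (𝓝 (∫ y, (∫ x, h x y) ∂(limitLaw P' W s))) := by
  have hc := continuous_uncurry_of_lipschitz hL hh
  have hcx : ∀ x, Continuous (h x) := fun x =>
    hc.comp (Continuous.prodMk_right x)
  have hxL : ∀ y x x', |h x y - h x' y| ≤ L * |x - x'| := fun y x x' => by
    simpa using hh x x' y y
  have hyL : ∀ x y y', |h x y - h x y'| ≤ L * ‖y - y'‖ := fun x y y' => by
    simpa using hh x x y y'
  set Φ : EuclideanSpace ℝ (Fin m) → ℝ := fun y => ∫ x, h x y with hΦ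
  -- Integrating over a fixed compact interval makes `Φ` continuous and bounded. The margin `1` is
  -- there because interval integrals use half-open intervals.
  have hΦe : ∀ y, Φ y = ∫ x in -(M + 1)..(M + 1), h x y := by
    intro y
    refine (intervalIntegral.integral_eq_integral_of_support_subset fun x hx => ?_).symm
    have := abs_le.1 (not_lt.1 fun hlt => hx (hhM x y hlt))
    constructor <;> linarith [this.1, this.2]
  have hΦc : Continuous Φ := by
    simp only [funext hΦe]
    exact intervalIntegral.continuous_parametric_intervalIntegral_of_continuous'
      (f := fun y x => h x y) (hc.comp continuous_swap) _ _
  have hΦB : ∀ y, |Φ y| ≤ B * |M + 1 - -(M + 1)| := fun y => by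
    rw [hΦe, ← Real.norm_eq_abs]
    exact intervalIntegral.norm_integral_le_of_norm_le_const fun x _ => hhB x y
  -- A horizon beyond all the times, whatever their order.
  set T : ℝ≥0 := t₀ + ∑ j, s j with hT
  set k : ℕ → ℕ := fun n => ⌊(n : ℝ≥0) * t₀⌋₊ with hk
  set r : ℕ → ℕ := fun n => ⌊(n : ℝ≥0) * T⌋₊ - k n with hr
  have hkr : ∀ n, k n + r n = ⌊(n : ℝ≥0) * T⌋₊ := fun n =>
    Nat.add_sub_of_le (Nat.floor_mono (by gcongr; exact le_self_add))
  have hkrT : ∀ n, ((k n + r n : ℕ) : ℝ) ≤ T * n := fun n => by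
    rw [hkr, mul_comm (T : ℝ)]
    exact_mod_cast Nat.floor_le (show 0 ≤ (n : ℝ≥0) * T by positivity)
  have hsN : ∀ (n : ℕ) j, ⌊(n : ℝ≥0) * s j⌋₊ ≤ k n + r n := fun n j => by
    rw [hkr]
    refine Nat.floor_mono ?_
    gcongr
    exact (Finset.single_le_sum (fun _ _ => zero_le) (Finset.mem_univ j)).trans le_add_self
  set a : ℕ → ℕ → EuclideanSpace ℝ (Fin m) :=
    fun n => stepVec n fun j => ⌊(n : ℝ≥0) * s j⌋₊ with ha
  set l : ℕ → List (EuclideanSpace ℝ (Fin m)) :=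
    fun n => twoSidedSteps (a n) (k n) (r n) with hl
  have hclt : Tendsto (fun n => ∫ y, Φ y ∂(signMeasure (l n))) atTop
      (𝓝 (∫ y, Φ y ∂(limitLaw P' W s))) :=
    tendsto_integral_signMeasure hW s (fun n j => ⌊(n : ℝ≥0) * s j⌋₊) (fun n => k n + r n) hsN
      (fun j => tendsto_floor_mul_div (s j)) l (fun n x => prod_cos_twoSidedSteps _ _ _ x) hΦc hΦB
  have hmid : Tendsto (fun n => midWeight (K n)) atTop (𝓝 1) := tendsto_sqrt_mul_choose_half.comp hK
  set D : ℝ := 4 * L * √m * T * (M ^ 2 + 4 * T + 1) with hD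
  -- `e₁` is the cost of replacing the walk by fair signs, `e₂` that of replacing the sum over
  -- vertices by the Lebesgue integral.
  set e₁ : ℕ → ℝ := fun n => 2 * (M + 1) * midWeight (K n) * (D * (n / K n)) with he₁
  set e₂ : ℕ → ℝ := fun n => 2 * (M + 1) * (B * (|midWeight (K n) - 1|
    + midWeight (K n) * (M ^ 2 * (n / K n)))) + 4 * L * (M + 3) / √(n : ℝ) with he₂
  have he : Tendsto (fun n => e₁ n + e₂ n) atTop (𝓝 0) := by
    have h1 : Tendsto e₁ atTop (𝓝 0) := by
      simpa using (hmid.const_mul (2 * (M + 1))).mul (hslow.const_mul D)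
    have h2 : Tendsto (fun n : ℕ => 4 * L * (M + 3) / √(n : ℝ)) atTop (𝓝 0) :=
      (Real.tendsto_sqrt_atTop.comp tendsto_natCast_atTop_atTop).const_div_atTop _
    have h3 : Tendsto (fun n => |midWeight (K n) - 1|) atTop (𝓝 0) := by
      simpa using (hmid.sub_const 1).abs
    have h4 := hmid.mul (hslow.const_mul (M ^ 2))
    have h5 := (((h3.add h4).const_mul B).const_mul (2 * (M + 1))).add h2
    simpa using h1.add h5
  rw [← tendsto_sub_nhds_zero_iff] at hclt ⊢
  have hkey : ∀ᶠ n : ℕ in atTop, ‖√(2 * Real.pi * ((K n : ℝ) / (n : ℝ))) *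
        ∫ ω, h (processZ (Y (K n)) n t₀ ω)
          (WithLp.toLp 2 fun j => deltaZ (Y (K n)) n (s j) ω) ∂(P (K n))
      - ∫ y, Φ y ∂(signMeasure (l n))‖ ≤ e₁ n + e₂ n := by
    have hMK : ∀ᶠ n : ℕ in atTop, M * √(n : ℝ) < K n := by
      have hpos : (0 : ℝ) < 1 / (M + 1) := by positivity
      filter_upwards [hslow.eventually (gt_mem_nhds hpos), eventually_gt_atTop 0,
        hK.eventually_gt_atTop 0] with n h1 hn hKn
      have hKn' : (0 : ℝ) < K n := by exact_mod_cast hKn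
      have hs1 : 1 ≤ √(n : ℝ) := Real.one_le_sqrt.2 (by exact_mod_cast hn)
      have hss : √(n : ℝ) ^ 2 = n := Real.sq_sqrt (by positivity)
      rw [div_lt_div_iff₀ hKn' (by positivity), one_mul] at h1
      nlinarith
    filter_upwards [hMK, eventually_gt_atTop 0, hK.eventually_gt_atTop 0] with n hMKn hn hKn
    have hs0 : 0 < √(n : ℝ) := by positivity
    have hrw := hY (K n) hKn
    have e := hrw.integral_two_sided (a n) (k n) (r n) fun u y => h (coordSum u / √(n : ℝ)) y
    have e' : ∀ ω, ∑ i ∈ Finset.range (k n + r n), (coordSum (Y (K n) (i + 1) ω)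
        - coordSum (Y (K n) i ω)) • a n i
          = WithLp.toLp 2 fun j => deltaZ (Y (K n)) n (s j) ω := fun ω => by
      ext j
      exact sum_increments_smul_stepVec (Y (K n)) n s _ (hsN n) ω j
    simp only [e'] at e
    have e'' : ∀ ω, coordSum (Y (K n) (k n) ω) / √(n : ℝ) = processZ (Y (K n)) n t₀ ω :=
      fun ω => rfl
    simp only [e''] at e
    rw [e]
    set A : Cube (K n) → ℝ := fun u =>
      walkExp (((List.range' 0 (k n)).map (a n)).map fun a => -a).reverse (fun _ x =>
        walkExp ((List.range' (k n) (r n)).map (a n)) (fun _ y => h (coordSum u / √(n : ℝ)) (x + y)) u) u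
      with hA
    set S : Cube (K n) → ℝ := fun u => signAvg (l n) (h (coordSum u / √(n : ℝ))) with hS
    have hb1 : |√(2 * Real.pi * ((K n : ℝ) / n)) * ((2⁻¹ : ℝ) ^ K n * ∑ u, (A u - S u))| ≤ e₁ n := by
      refine sum_cube_le_of_support (K n) n hn hM (by positivity) _ fun u => ?_
      split_ifs with hu
      · exact abs_two_sided_sub_signAvg_le hKn hn hL T.2 (by positivity)
          (fun i => norm_stepVec_le _ _ _) (hkrT n) (hyL _) u hu
      · have hz : ∀ y, h (coordSum u / √(n : ℝ)) y = 0 := fun y => by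
          refine hhM _ _ ?_
          rw [abs_div, abs_of_pos hs0, lt_div_iff₀ hs0]
          exact not_le.1 hu
        -- Outside the window the function of the increments is zero, hence Lipschitz with constant
        -- `0`, and the same estimate gives a zero error.
        have := abs_two_sided_sub_signAvg_le (L := 0) (M := |coordSum u| / √(n : ℝ)) hKn hn le_rfl
          T.2 (by positivity) (fun i => norm_stepVec_le n (fun j => ⌊(n : ℝ≥0) * s j⌋₊) i) (hkrT n)
          (h := h (coordSum u / √(n : ℝ))) (fun x y => by simp [hz]) u
          (by rw [div_mul_cancel₀ _ hs0.ne'])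
        rwa [mul_zero, zero_mul, zero_mul, zero_mul, zero_mul] at this
    -- The signs do not depend on `u`, so the sum over vertices can be taken at fixed `y`, inside
    -- the integral over the signs.
    set F : EuclideanSpace ℝ (Fin m) → ℝ := fun y => √(2 * Real.pi * ((K n : ℝ) / n)) *
      ((2⁻¹ : ℝ) ^ K n * ∑ u : Cube (K n), h (coordSum u / √(n : ℝ)) y) with hF
    have hFc : Continuous F := by
      refine continuous_const.mul (continuous_const.mul (continuous_finsetSum _ fun u _ => hcx _))
    have hFi : ∫ y, F y ∂(signMeasure (l n)) =
        √(2 * Real.pi * ((K n : ℝ) / n)) * ((2⁻¹ : ℝ) ^ K n * ∑ u, S u) := by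
      rw [integral_const_mul, integral_const_mul, integral_finsetSum _ fun u _ =>
        (integrable_signMeasure_and_integral_eq (l n) (hcx _)).1]
      congr 2
      exact Finset.sum_congr rfl fun u _ =>
        (integrable_signMeasure_and_integral_eq (l n) (hcx _)).2
    have hb2 : |∫ y, F y ∂(signMeasure (l n)) - ∫ y, Φ y ∂(signMeasure (l n))| ≤ e₂ n := by
      rw [← integral_sub (integrable_signMeasure_and_integral_eq (l n) hFc).1
        (integrable_signMeasure_and_integral_eq (l n) hΦc).1]
      refine (norm_integral_le_of_norm_le_const (μ := signMeasure (l n))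
        (f := fun y => F y - Φ y) (C := e₂ n) (Eventually.of_forall fun y => ?_)).trans
        (by rw [probReal_univ, mul_one])
      exact abs_sum_cube_sub_integral_le (K n) n hKn hn hL hM hMKn (hxL y) (fun x hx => hhM x y hx)
        fun x => hhB x y
    rw [hFi] at hb2
    rw [Finset.sum_sub_distrib, mul_sub, mul_sub] at hb1
    exact (abs_sub_le _ _ _).trans (add_le_add hb1 hb2)
  have := (squeeze_zero_norm' hkey he).add hclt
  simpa using this

end Assembly

theorem mainTheorem5
    -- For every `K`, the walk `Y_K` on the `K`-cube, started from the uniform law.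
    {Ω : ℕ → Type*} [∀ K, MeasurableSpace (Ω K)] (P : ∀ K, Measure (Ω K))
    [∀ K, IsProbabilityMeasure (P K)] (Y : ∀ K, ℕ → Ω K → Cube K)
    (hY : ∀ K, 1 ≤ K →
      IsSimpleRandomWalk (hypercubeGraph K) (PMF.uniformOfFintype (Cube K)) (P K) (Y K))
    -- The slow regime, with `K = K(n)`.
    (K : ℕ → ℕ) (hK : Tendsto K atTop atTop)
    (hslow : Tendsto (fun n : ℕ => (n : ℝ) / (K n : ℝ)) atTop (𝓝 0))
    -- A standard Brownian motion.
    {Ω' : Type*} [MeasurableSpace Ω'] (P' : Measure Ω') [IsProbabilityMeasure P']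
    (W : ℝ≥0 → Ω' → ℝ) (hW : IsBrownianReal W P')
    -- The times `0 ≤ t_1 < ... < t_s`, with `s = m + 1`, and the test function on `ℝ^s`.
    (m : ℕ) (t : Fin (m + 1) → ℝ≥0) (ht : StrictMono t)
    (φ : (Fin (m + 1) → ℝ) → ℝ) (hφ : ContDiff ℝ ((⊤ : ℕ∞) : WithTop ℕ∞) φ) (hφc : HasCompactSupport φ) :
    Tendsto
      (fun n : ℕ => √(2 * Real.pi * ((K n : ℝ) / (n : ℝ))) *
        ∫ ω, φ (Fin.cons (processZ (Y (K n)) n (t 0) ω)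
          (fun j : Fin m => deltaZ (Y (K n)) n (t j.succ) ω)) ∂(P (K n)))
      atTop
      (𝓝 (∫ x : ℝ, ∫ ω, φ (Fin.cons x (fun j : Fin m => 2 * W (t j.succ) ω)) ∂P')) := by
  obtain ⟨L, hL⟩ := hφ.lipschitzWith_of_hasCompactSupport hφc (by simp)
  obtain ⟨B, hB⟩ := hφc.exists_bound_of_continuous hφ.continuous
  obtain ⟨M, hM⟩ := hφc.isCompact.isBounded.exists_norm_le
  set h : ℝ → EuclideanSpace ℝ (Fin m) → ℝ := fun x y => φ (Fin.cons x fun j => y j) with hh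
  have hhL : ∀ x x' y y', |h x y - h x' y'| ≤ L * (|x - x'| + ‖y - y'‖) := by
    intro x x' y y'
    rw [← Real.dist_eq]
    refine (hL.dist_le_mul _ _).trans (mul_le_mul_of_nonneg_left ?_ L.2)
    refine (dist_pi_le_iff (by positivity)).2 fun i => ?_
    refine Fin.cases ?_ (fun j => ?_) i
    · simp [Real.dist_eq]
    · simp only [Fin.cons_succ, Real.dist_eq]
      have := PiLp.norm_apply_le (y - y') j
      rw [PiLp.sub_apply, Real.norm_eq_abs] at this
      exact this.trans (by simp)
  -- The bound `M` may be negative when the support is empty, hence the maximum with `0`.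
  have hhM : ∀ x y, max M 0 < |x| → h x y = 0 := by
    intro x y hx
    by_contra hne
    have h1 := hM _ (subset_tsupport φ hne)
    have h2 := norm_le_pi_norm (Fin.cons x fun j => y j : Fin (m + 1) → ℝ) 0
    rw [Fin.cons_zero, Real.norm_eq_abs] at h2
    exact absurd hx (not_lt.2 ((h2.trans h1).trans (le_max_left _ _)))
  have hhB : ∀ x y, |h x y| ≤ B := fun x y => hB _
  have hc := continuous_uncurry_of_lipschitz L.2 hhL
  have hmain := tendsto_integral_of_lipschitz P Y hY K hK hslow P' W hW.toIsPreBrownianReal (t 0)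
    (fun j => t j.succ) h L.2 (le_max_right M 0) hhL hhM hhB
  have hWm : AEMeasurable (fun ω => (WithLp.toLp 2 fun j : Fin m => 2 * W (t j.succ) ω :
      EuclideanSpace ℝ (Fin m))) P' :=
    (HasGaussianLaw.toLp_pi 2 (X := fun (j : Fin m) ω => 2 * W (t j.succ) ω)
      ((hW.toIsPreBrownianReal.hasGaussianLaw_pi fun j => t j.succ).fun_smul 2)).aemeasurable
  have : IsProbabilityMeasure (limitLaw P' W fun j : Fin m => t j.succ) :=
    Measure.isProbabilityMeasure_map hWm
  have hint : Integrable (Function.uncurry h)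
      (volume.prod (limitLaw P' W fun j : Fin m => t j.succ)) := by
    have hi : Integrable ((Set.Icc (-(max M 0)) (max M 0)).indicator fun _ : ℝ => B) :=
      (integrable_indicator_iff measurableSet_Icc).2 (by simp)
    refine (hi.comp_fst _).mono' hc.aestronglyMeasurable (Eventually.of_forall fun p => ?_)
    by_cases hp : p.1 ∈ Set.Icc (-(max M 0)) (max M 0)
    · rw [Set.indicator_of_mem hp]
      exact hhB _ _
    · rw [Set.indicator_of_notMem hp]
      have : max M 0 < |p.1| := by
        rw [← not_le, abs_le]
        exact hp
      simp [Function.uncurry, hhM p.1 p.2 this]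
  rw [← integral_integral_swap hint] at hmain
  have hmap : ∀ x, ∫ y, h x y ∂(limitLaw P' W fun j : Fin m => t j.succ)
      = ∫ ω, φ (Fin.cons x (fun j : Fin m => 2 * W (t j.succ) ω)) ∂P' := fun x => by
    rw [limitLaw, integral_map hWm]
    exact (hc.comp (Continuous.prodMk_right x)).aestronglyMeasurable
  simp only [hmap] at hmain
  exact hmain
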